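/- Let $\mathbb{Q}_{\mathbb{C}}$ be the algebra of complexified quaternions $q=s+x\mathbf i+y\mathbf j+z\mathbf k$, $s,x,y,z\in\mathbb{C}$, with conjugation $q^*=s-x\mathbf i-y\mathbf j-z\mathbf k$. For an $n\times n$ matrix $X$ over $\mathbb{Q}_{\mathbb{C}}$ let $$\mathrm{Det}_M(X)=\sum_{\sigma\in S_n}\varepsilon(\sigma)\,(X_{n_1i_2}X_{i_2i_3}\cdots X_{i_sn_1})\cdots(X_{n_rk_2}X_{k_2k_3}\cdots X_{k_ln_r})$$ be its Moore–Dyson determinant, where $\sigma=(n_1i_2\ldots i_s)\cdots(n_rk_2\ldots k_l)$ is written as a product of cycles, each starting with its largest element, and $n_1>\dots>n_r$. Let $(\Lambda,\mu)$ be a $\sigma$-finite measure space and let $\mathcal X$ be a Pfaffian random point field on $\Lambda$ with kernel $K:\Lambda\times\Lambda\to\mathbb{Q}_{\mathbb{C}}$: $K(y,x)=K(x,y)^*$ for all $x,y$, and for every $m\ge 1$ the $m$-point correlation function of $\mathcal X$ with respect to $\mu$ is $R_m(x_1,\dots,x_m)=\mathrm{Det}_M\big(K(x_i,x_j)\big)_{1\le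 i,j\le m}$ (almost everywhere). Here a function $R_k\ge 0$ on $\Lambda^k$ is the $k$-point correlation function if for all disjoint measurable sets $A_1,\dots,A_m$ and all $k_1+\dots+k_m=k$ $$\mathbb{E}\prod_{i=1}^m \#(A_i)\,(\#(A_i)-1)\cdots(\#(A_i)-k_i+1)=\int_{A_1^{k_1}\times\dots\times A_m^{k_m}}R_k\,d\mu^k ,$$ $\#(A)$ being the number of points of $\mathcal X$ in $A$. Suppose that $K$ has finite rank: $K(x,y)=\sum_{k=1}^n f_k(x)g_k(y)$ with finitely many measurable functions $f_k,g_k:\Lambda\to\mathbb{Q}_{\mathbb{C}}$ such that all products $g_kf_l$ are $\mu$-integrable (for example, with square-integrable $f_k,g_k$). Then the formula $(Kv)(x)=\int_\Lambda K(x,y)v(y)\,d\mu(y)$ defines a linear operator on the space of all (classes of) measurable $v:\Lambda\to\mathbb{Q}_{\mathbb{C}}$ for which the integral converges absolutely for almost every $x$. The rank $r$ of this operator over $\mathbb{Q}_{\mathbb{C}}$ (a quarter of the complex dimension of its range) is a finite integer, and it has $r$ eigenvalues $\lambda_1,\dots,\lambda_r\in\mathbb{C}$, where each nonzero eigenvalue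 is listed with its algebraic multiplicity over $\mathbb{Q}_{\mathbb{C}}$ (a quarter of the complex dimension of the space of its generalized eigenfunctions) and the remaining entries of the list, if any, are $0$. The total number $\mathcal N$ of points of $\mathcal X$ in $\Lambda$ is almost surely finite, and for every $t\in\mathbb{R}$ $$\mathbb{E}\,e^{i\mathcal N t}=\prod_{k=1}^r\big(1+(e^{it}-1)\lambda_k\big)=\mathrm{Det}_M\big(I+(e^{it}-1)K\big),$$ where, for a self-dual kernel $L$, $$\mathrm{Det}_M(I+L)=1+\sum_{n=1}^\infty\frac1{n!}\int_{\Lambda^n}\mathrm{Det}_M\big(L(x_i,x_j)\big)_{1\le i,j\le n}\,d\mu(x_1)\cdots d\mu(x_n)$$ is the quaternion Fredholm determinant; for $L=(e^{it}-1)K$ the integrals converge absolutely and the series converges. -/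

import Mathlib

open MeasureTheory Filter
open scoped Quaternion ENNReal

noncomputable section

namespace PfaffianField

/-! ### Complexified quaternions -/

/-- Mathlib's quaternions over a commutative ring (the ring structure of `R` determines the
constants `0`, `1`, `-1` that Mathlib's type depends on). -/
abbrev QuaternionsOver (R : Type*) [CommRing R] : Type _ := ℍ[R]

/-- The algebra of complexified quaternions `s + xi + yj + zk` with complex `s, x, y, z`. Its `star`
is the `ℂ`-linear quaternion conjugation `s + xi + yj + zk ↦ s - xi - yj - zk`. -/
abbrev QC : Type := QuaternionsOver ℂ

/-- The sup norm of the four complex coordinates. It only serves to speak about integrals and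
convergent series in the 4-dimensional complex vector space `QC`; every norm would do. -/
instance instNormedAddCommGroup : NormedAddCommGroup QC :=
  { NormedAddCommGroup.induced QC (Fin 4 → ℂ)
      (QuaternionAlgebra.linearEquivTuple (-1 : ℂ) (0 : ℂ) (-1 : ℂ))
      (LinearEquiv.injective _) with
    toAddCommGroup := Ring.toAddCommGroup }

instance instNormedSpace : NormedSpace ℂ QC :=
  { toModule := Algebra.toModule
    norm_smul_le := (NormedSpace.induced ℂ QC (Fin 4 → ℂ)
      (QuaternionAlgebra.linearEquivTuple (-1 : ℂ) (0 : ℂ) (-1 : ℂ))).norm_smul_le }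

/-! ### The Moore-Dyson determinant -/

open scoped Classical in
/-- The factor contributed by `a` to the term of `σ` in the Moore-Dyson determinant: if `a` is the
largest element of its cycle `(a i₂ … iₛ)`, this is the ordered product
`X a i₂ * X i₂ i₃ * ⋯ * X iₛ a`; otherwise it is `1`. -/
def cycleFactor {n : ℕ} (X : Matrix (Fin n) (Fin n) QC) (σ : Equiv.Perm (Fin n)) (a : Fin n) :
    QC :=
  if ∀ b, σ.SameCycle a b → b ≤ a then
    ((List.range (Function.minimalPeriod σ a)).map
      fun j => X ((σ ^ j) a) ((σ ^ (j + 1)) a)).prod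
  else 1

/-- The Moore-Dyson determinant of a quaternion matrix: the signed sum over all permutations of
the ordered products of their cycles. Each cycle starts at its largest element, and the cycles are
taken in decreasing order of their largest elements. -/
def mooreDet {n : ℕ} (X : Matrix (Fin n) (Fin n) QC) : QC :=
  ∑ σ : Equiv.Perm (Fin n),
    ((Equiv.Perm.sign σ : ℤ) : QC) * ((List.finRange n).reverse.map (cycleFactor X σ)).prod

/-! ### Random point fields -/

/-- A countable configuration of points of `Λ`, points being allowed to have finite
multiplicities (`mult x` is the number of points at `x`). -/
@[ext] structure Configuration (Λ : Type*) where
  mult : Λ → ℕ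
  countable_support : (Function.support mult).Countable

variable {Λ : Type*}

/-- `#(A)`: the number of points of the configuration in `A`, with multiplicities. -/
def Configuration.count (c : Configuration Λ) (A : Set Λ) : ℕ∞ :=
  {p : Λ × ℕ | p.1 ∈ A ∧ p.2 < c.mult p.1}.encard

variable [MeasurableSpace Λ]

/-- The σ-algebra on configurations generated by the counts `#(A)`, `A` measurable. A random point
field on `Λ` is a probability measure on this measurable space. -/
instance Configuration.instMeasurableSpace : MeasurableSpace (Configuration Λ) :=
  ⨆ (A : Set Λ) (_ : MeasurableSet A),
    MeasurableSpace.comap (fun c : Configuration Λ => c.count A) inferInstance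

/-- The falling factorial `n (n - 1) ⋯ (n - k + 1)` of a possibly infinite count. -/
def fallingFactorial (n : ℕ∞) (k : ℕ) : ℝ≥0∞ :=
  ∏ j ∈ Finset.range k, ((n : ℝ≥0∞) - (j : ℝ≥0∞))

/-- `R : Λᵏ → ℝ₊` is a `k`-point correlation function of the point field `P` with respect to `μ`:
`E ∏ᵢ #(Aᵢ) ⋯ (#(Aᵢ) - kᵢ + 1) = ∫ R` over `A₁^k₁ × ⋯ × Aₘ^kₘ` for all disjoint measurable `Aᵢ` and
all `k₁ + ⋯ + kₘ = k`. Both sides are taken in `[0, ∞]`, so no integrability has to be imposed on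
`R` beforehand. -/
structure IsCorrelationFunction (P : Measure (Configuration Λ)) (μ : Measure Λ) (k : ℕ)
    (R : (Fin k → Λ) → ℝ) : Prop where
  aemeasurable : AEMeasurable R (Measure.pi fun _ => μ)
  nonneg : ∀ x, 0 ≤ R x
  lintegral_eq : ∀ (m : ℕ) (A : Fin m → Set Λ) (κ : Fin m → ℕ) (h : ∑ i, κ i = k),
    (∀ i, MeasurableSet (A i)) → Pairwise (fun i j => Disjoint (A i) (A j)) →
    ∫⁻ c, ∏ i, fallingFactorial (c.count (A i)) (κ i) ∂P =
      ∫⁻ x in {x : Fin k → Λ | ∀ i j, x (Fin.cast h (finSigmaFinEquiv ⟨i, j⟩)) ∈ A i},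
        ENNReal.ofReal (R x) ∂(Measure.pi fun _ => μ)

/-- `P` is a Pfaffian random point field with the self-dual quaternion kernel `K`: its correlation
functions of all orders exist and equal (almost everywhere) the Moore-Dyson determinants of the
matrices `(K (xᵢ, xⱼ))`. -/
structure IsPfaffianField (P : Measure (Configuration Λ)) (μ : Measure Λ)
    (K : Λ → Λ → QC) : Prop where
  selfDual : ∀ x y, K y x = star (K x y)
  correlation : ∀ m : ℕ, 1 ≤ m → ∃ R : (Fin m → Λ) → ℝ, IsCorrelationFunction P μ m R ∧
    ∀ᵐ x ∂(Measure.pi fun _ : Fin m => μ),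
      (((R x : ℝ) : ℂ) : QC) = mooreDet (Matrix.of fun i j => K (x i) (x j))

/-! ### Finite-rank kernels, their rank and their eigenvalues -/

/-- `K` is a finite-rank kernel: `K (x, y) = ∑ₖ fₖ(x) gₖ(y)`, a finite sum with measurable
quaternion functions such that the products `gₖ fₗ` are integrable (so that the integral operator
with kernel `K` acts on the functions `fₗ`). This holds in particular when all `fₖ`, `gₖ` are
square-integrable. -/
def IsFiniteRankKernel (μ : Measure Λ) (K : Λ → Λ → QC) : Prop :=
  ∃ (n : ℕ) (f g : Fin n → Λ → QC),
    (∀ k, AEStronglyMeasurable (f k) μ) ∧ (∀ k, AEStronglyMeasurable (g k) μ) ∧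
    (∀ k l, Integrable (fun x => g k x * f l x) μ) ∧
    ∀ x y, K x y = ∑ k, f k x * g k y

/-- The space of (classes of) measurable quaternion functions `v` for which the integral
`∫ K (x, y) v(y) dμ(y)` converges absolutely for almost every `x`. -/
def kernelDomain (μ : Measure Λ) (K : Λ → Λ → QC) : Submodule ℂ (Λ →ₘ[μ] QC) where
  carrier := {v | ∀ᵐ x ∂μ, Integrable (fun y => K x y * v y) μ}
  add_mem' := by
    intro v w hv hw
    rw [Set.mem_ofPred_eq] at hv hw ⊢
    filter_upwards [hv, hw] with x hx hx'
    refine (hx.add hx').congr ?_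
    filter_upwards [AEEqFun.coeFn_add v w] with y hy
    simp only [hy, Pi.add_apply, mul_add]
  zero_mem' := by
    rw [Set.mem_ofPred_eq]
    refine Eventually.of_forall fun x => ?_
    refine (integrable_zero Λ QC μ).congr ?_
    filter_upwards [AEEqFun.coeFn_zero (α := Λ) (β := QC) (μ := μ)] with y hy
    simp only [hy, Pi.zero_apply, mul_zero]
  smul_mem' := by
    intro c v hv
    rw [Set.mem_ofPred_eq] at hv ⊢
    filter_upwards [hv] with x hx
    refine (hx.smul c).congr ?_
    filter_upwards [AEEqFun.coeFn_smul c v] with y hy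
    simp only [hy, Pi.smul_apply, mul_smul_comm]

/-- `T` is the integral operator with kernel `K`, `(T v)(x) = ∫ K (x, y) v(y) dμ(y)`. -/
def IsIntegralOperator (μ : Measure Λ) (K : Λ → Λ → QC)
    (T : Module.End ℂ (kernelDomain μ K)) : Prop :=
  ∀ v : kernelDomain μ K,
    (((T v : kernelDomain μ K) : Λ →ₘ[μ] QC) : Λ → QC) =ᵐ[μ]
      fun x => ∫ y, K x y * (v : Λ →ₘ[μ] QC) y ∂μ

/-- `T` has rank `r` over the quaternions. The range of an integral operator is a right module
over `QC`, which has dimension 4 over `ℂ`. -/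
def HasQuaternionRank {E : Type*} [AddCommGroup E] [Module ℂ E] (T : Module.End ℂ E) (r : ℕ) :
    Prop :=
  Module.Finite ℂ (LinearMap.range T) ∧ Module.finrank ℂ (LinearMap.range T) = 4 * r

/-- `lam` lists the eigenvalues of the operator `T` of quaternion rank `r`: every nonzero complex
number `c` occurs as often as its algebraic multiplicity over the quaternions says (a quarter of
the complex dimension of the space of generalized eigenfunctions `v`, `(T - c)ⁿ v = 0`); if these
are fewer than `r`, the list is filled up with the eigenvalue `0`. -/
def IsEigenvalueList {E : Type*} [AddCommGroup E] [Module ℂ E] (T : Module.End ℂ E) {r : ℕ}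
    (lam : Fin r → ℂ) : Prop :=
  ∀ c : ℂ, c ≠ 0 → Module.finrank ℂ (T.maxGenEigenspace c) = 4 * Nat.card {k // lam k = c}

/-! ### The quaternion Fredholm determinant -/

/-- `D` is the quaternion Fredholm determinant `Det_M (I + K)`, the sum of the convergent series
`1 + ∑_{n ≥ 1} (1 / n!) ∫_{Λⁿ} Det_M (K (xᵢ, xⱼ)) dμⁿ`, all of whose integrals converge
absolutely. -/
def IsFredholmDet (μ : Measure Λ) (K : Λ → Λ → QC) (D : QC) : Prop :=
  (∀ n : ℕ, 1 ≤ n → Integrable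
    (fun x : Fin n → Λ => mooreDet (Matrix.of fun i j => K (x i) (x j)))
    (Measure.pi fun _ => μ)) ∧
  ∃ S : QC, D = 1 + S ∧
    HasSum (fun n : ℕ => (((n + 1).factorial : ℂ)⁻¹) •
      ∫ x : Fin (n + 1) → Λ, mooreDet (Matrix.of fun i j => K (x i) (x j))
        ∂(Measure.pi fun _ => μ)) S

end PfaffianField

end

noncomputable section

namespace PfaffianField

/-! ### Traces along the cycles of a permutation -/

section CycleTraces

open Equiv

/-! Reversing a cycle of a permutation keeps its sign and, for a self-dual matrix, dualizes the
product along that cycle. Averaging over reversals replaces each cycle product by its scalar part,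
so the Moore–Dyson determinant is a commutative expression (`mooreDet_eq_sum_prod_re`).

The algebra is a copy of the complex 2 × 2 matrices. With a primitive idempotent `proj`, a
finite-rank kernel becomes a sum of `aᵢ(x) bᵢ(y)` where `bᵢ aⱼ` is a complex multiple of `proj`. The
scalar part of a cycle product is then half the trace of a product of complex matrices, one per
point. Fubini turns the integral over `Λⁿ` into the signed sum over permutations of the product over
cycles of `tr(G^length) / 2`, with `G = gram μ a b`. If `tr Gˡ = 2 ∑ λₖˡ` for all `l`, this sum is
`n!` times the elementary symmetric function `eₙ(λ)` (`integral_mooreDet_kernel`).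

The doubling comes from self-duality. In a shortest factorization the `bᵢ` are the duals of the `aⱼ`
up to an invertible antisymmetric matrix `γ`, and `G = γ ω` with `ω` antisymmetric too. Since `(γ ω
- c)ᵏ γ` is antisymmetric, it has even rank, so every eigenvalue of `G` has even multiplicity
(`exists_half_spectrum`).

The integral operator factors as `F H` through `ℂᴺ × ℂᴺ`, with `H` onto, `F` injective and `H F = G
⊕ G`. This gives complex rank `2N = 4r` and the multiplicities of nonzero eigenvalues
(`exists_integralOperator`).

Finally, the `k`-th factorial moment of the number of points is `k! eₖ(λ)`. It vanishes for `k = r +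
1`, so there are almost surely at most `r` points, and the characteristic function and the Fredholm
series are the same finite expansion of `∏ (1 + z λₖ)`, `z = e^{it} - 1`. -/

lemma prod_range_succ_apply {ι R : Type*} [Fintype ι] [DecidableEq ι] [CommRing R]
    (W : ℕ → Matrix ι ι R) (q : ℕ) (u v : ι) :
    ((List.range (q + 1)).map W).prod u v =
      ∑ h : Fin q → ι, ∏ t : Fin (q + 1),
        W t ((Fin.cons u h : Fin (q + 1) → ι) t) ((Fin.snoc h v : Fin (q + 1) → ι) t) := by
  induction q generalizing v with
  | zero => simp [Fin.snoc]
  | succ q ih =>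
    rw [List.range_succ, List.map_append, List.prod_append, Matrix.mul_apply]
    simp only [List.map_cons, List.map_nil, List.prod_cons, List.prod_nil, mul_one, ih]
    rw [← (Fin.snocEquiv fun _ : Fin (q + 1) => ι).sum_comp, Fintype.sum_prod_type]
    refine Finset.sum_congr rfl fun w _ => ?_
    rw [Finset.sum_mul]
    refine Finset.sum_congr rfl fun h _ => ?_
    have hs : (Fin.snocEquiv fun _ : Fin (q + 1) => ι) (w, h) = Fin.snoc h w := rfl
    rw [Fin.prod_univ_castSucc (n := q + 1), hs]
    simp only [Fin.cons_snoc_eq_snoc_cons, Fin.snoc_castSucc, Fin.snoc_last,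
      Fin.val_castSucc, Fin.val_last]

/-- Taking the trace identifies the two ends of the index path, so the successor of position `t` is
given by rotation. -/
lemma trace_prod_range {ι R : Type*} [Fintype ι] [DecidableEq ι] [CommRing R]
    (W : ℕ → Matrix ι ι R) (p : ℕ) (hp : p ≠ 0) :
    (((List.range p).map W).prod).trace =
      ∑ h : Fin p → ι, ∏ t : Fin p, W t (h t) (h (finRotate p t)) := by
  obtain ⟨q, rfl⟩ := Nat.exists_eq_succ_of_ne_zero hp
  rw [Matrix.trace, ← (Fin.consEquiv fun _ : Fin (q + 1) => ι).sum_comp, Fintype.sum_prod_type]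
  refine Finset.sum_congr rfl fun u _ => ?_
  rw [Matrix.diag_apply]
  refine (prod_range_succ_apply W q u u).trans (Finset.sum_congr rfl fun h _ => ?_)
  rw [Fin.snoc_eq_cons_rotate]
  rfl

/-- `a` is the largest element of its cycle in `σ`. -/
def IsCycleMax {α : Type*} [LinearOrder α] (σ : Perm α) (a : α) : Prop :=
  ∀ b, σ.SameCycle a b → b ≤ a

lemma minimalPeriod_perm_pos {α : Type*} [Finite α] (σ : Perm α) (a : α) :
    0 < Function.minimalPeriod σ a :=
  Function.minimalPeriod_pos_of_mem_periodicPts (σ.injective.mem_periodicPts a)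

lemma pow_minimalPeriod_apply {α : Type*} (σ : Perm α) (a : α) :
    (σ ^ Function.minimalPeriod σ a) a = a := by
  rw [← Perm.iterate_eq_pow]
  exact Function.isPeriodicPt_minimalPeriod σ a

lemma IsCycleMax.eq {α : Type*} [LinearOrder α] {σ : Perm α} {a b : α} (ha : IsCycleMax σ a)
    (hb : IsCycleMax σ b) (h : σ.SameCycle a b) : a = b :=
  le_antisymm (hb a h.symm) (ha b h)

lemma exists_isCycleMax {α : Type*} [LinearOrder α] [Finite α] (σ : Perm α) (b : α) :
    ∃ a, IsCycleMax σ a ∧ σ.SameCycle a b := by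
  obtain ⟨a, ha, hmax⟩ := Set.exists_max_image {a | σ.SameCycle a b} id (Set.toFinite _)
    ⟨b, Perm.SameCycle.refl σ b⟩
  exact ⟨a, fun c hc => hmax c (hc.symm.trans ha), ha⟩

/-- Every element is reached exactly once by starting at the maximum of its cycle and iterating
fewer times than the period. These are the coordinates in which a product over all points splits
into cycles. -/
lemma bijective_pow_apply_isCycleMax {α : Type*} [LinearOrder α] [Finite α] (σ : Perm α) :
    Function.Bijective (fun p : Σ a : {a // IsCycleMax σ a},
      Fin (Function.minimalPeriod σ a.1) => (σ ^ (p.2 : ℕ)) p.1.1) := by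
  constructor
  · rintro ⟨⟨a, ha⟩, t⟩ ⟨⟨b, hb⟩, s⟩ h
    have hab : a = b := by
      refine ha.eq hb (Perm.SameCycle.trans (y := (σ ^ (t : ℕ)) a) ⟨t, by simp⟩ ?_)
      have h' : (σ ^ (t : ℕ)) a = (σ ^ (s : ℕ)) b := h
      rw [h']
      exact Perm.SameCycle.symm ⟨s, by simp⟩
    subst hab
    have hts : (t : ℕ) = s := by
      refine Function.iterate_injOn_Iio_minimalPeriod (f := σ) (x := a) t.2 s.2 ?_
      simpa only [Perm.iterate_eq_pow] using h
    rw [Fin.ext hts]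
  · intro b
    obtain ⟨a, ha, hab⟩ := exists_isCycleMax σ b
    obtain ⟨i, rfl⟩ := hab.exists_nat_pow_eq
    refine ⟨⟨⟨a, ha⟩, ⟨i % Function.minimalPeriod σ a,
      Nat.mod_lt _ (minimalPeriod_perm_pos σ a)⟩⟩, ?_⟩
    simp only [← Perm.iterate_eq_pow]
    exact Function.iterate_mod_minimalPeriod_eq

/-- In the coordinates (cycle, position) the permutation acts by rotating the position; the
wrap-around at the last position is periodicity. -/
lemma pow_finRotate_apply {α : Type*} (σ : Perm α) (a : α)
    (t : Fin (Function.minimalPeriod σ a)) :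
    (σ ^ (finRotate _ t : ℕ)) a = σ ((σ ^ (t : ℕ)) a) := by
  have hp := pow_minimalPeriod_apply σ a
  generalize Function.minimalPeriod σ a = p at t hp
  rw [← Perm.mul_apply, ← pow_succ']
  cases p with
  | zero => exact t.elim0
  | succ q =>
    rcases Fin.eq_castSucc_or_eq_last t with ⟨s, rfl⟩ | rfl
    · simp [finRotate_apply]
    · simp [hp]

open scoped Classical in
/-- Traces of matrix products along the cycles of a permutation, as one sum over all labellings. -/
lemma prod_trace_cycles {α ι R : Type*} [LinearOrder α] [Fintype α] [Fintype ι]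
    [DecidableEq ι] [CommRing R] (W : α → Matrix ι ι R) (σ : Perm α) :
    ∏ a, (if IsCycleMax σ a then
        (((List.range (Function.minimalPeriod σ a)).map fun j => W ((σ ^ j) a)).prod).trace else 1) =
      ∑ i : α → ι, ∏ x, W x (i x) (i (σ x)) := by
  rw [← Finset.prod_filter, Finset.prod_subtype (p := IsCycleMax σ) _ (by simp)]
  simp_rw [fun a : {a // IsCycleMax σ a} => trace_prod_range (fun j => W ((σ ^ j) a.1)) _
    (minimalPeriod_perm_pos σ a.1).ne']
  rw [Finset.prod_univ_sum, Fintype.piFinset_univ]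
  let e := Equiv.ofBijective _ (bijective_pow_apply_isCycleMax σ)
  rw [← (Equiv.arrowCongr e (Equiv.refl ι)).sum_comp,
    ← (Equiv.piCurry (fun (a : {a // IsCycleMax σ a})
      (_ : Fin (Function.minimalPeriod σ a.1)) => ι)).sum_comp]
  refine Finset.sum_congr rfl fun h _ => ?_
  rw [← Fintype.prod_sigma', ← e.prod_comp]
  refine Finset.prod_congr rfl fun p _ => ?_
  have he : σ (e p) = e ⟨p.1, finRotate _ p.2⟩ :=
    (pow_finRotate_apply σ p.1.1 p.2).symm
  rw [he]
  simp only [Equiv.arrowCongr_apply, Function.comp_apply, Equiv.symm_apply_apply, Equiv.refl_apply]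
  rfl

end CycleTraces

/-! ### The Moore-Dyson determinant of a self-dual matrix is a scalar -/

section MooreDeterminant

open Equiv

lemma smul_eq_coe_mul (c : ℂ) (q : QC) : c • q = (c : QC) * q := by
  ext <;> simp

lemma coe_sum {S : Type*} (s : Finset S) (f : S → ℂ) :
    ((∑ i ∈ s, f i : ℂ) : QC) = ∑ i ∈ s, (f i : QC) :=
  map_sum (algebraMap ℂ QC) f s

lemma re_sum {S : Type*} (s : Finset S) (f : S → QC) : (∑ i ∈ s, f i).re = ∑ i ∈ s, (f i).re :=
  map_sum (QuaternionAlgebra.reₗ (-1 : ℂ) 0 (-1)) f s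

lemma re_smul (c : ℂ) (q : QC) : (c • q).re = c * q.re := by
  simp

lemma re_star (q : QC) : (star q).re = q.re := by
  simp

lemma re_mul_comm (p q : QC) : (p * q).re = (q * p).re := by
  simp
  ring

lemma self_add_star_eq (q : QC) : q + star q = (2 * q.re) • (1 : QC) := by
  ext <;> simp [two_mul]

/-- Replacing factors by their duals through sign-preserving involutions turns every factor into
its scalar part. -/
lemma sum_smul_prod_eq_sum_prod_re {S α : Type*} [Fintype S] (Y : α → S → QC) (ρ : α → S → S)
    (hρ : ∀ a, Function.Involutive (ρ a)) (hY : ∀ a b s, b ≠ a → Y b (ρ a s) = Y b s)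
    (hstar : ∀ a s, Y a (ρ a s) = star (Y a s)) (l : List α) (hl : l.Nodup) (z : S → ℂ)
    (hz : ∀ a s, z (ρ a s) = z s) :
    ∑ s, z s • (l.map fun a => Y a s).prod =
      ((∑ s, z s * (l.map fun a => (Y a s).re).prod : ℂ) : QC) := by
  have hre : ∀ a b s, (Y b (ρ a s)).re = (Y b s).re := by
    intro a b s
    by_cases h : b = a
    · subst h; rw [hstar]; simp
    · rw [hY a b s h]
  -- The weight must vary: each scalar part, once extracted, is absorbed into `z`.
  induction l generalizing z with
  | nil => simp [coe_sum, smul_eq_coe_mul]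
  | cons a l ih =>
    have hP : ∀ s, (l.map fun b => Y b (ρ a s)).prod = (l.map fun b => Y b s).prod := by
      intro s
      congr 1
      refine List.map_congr_left fun b hb => hY a b s ?_
      rintro rfl
      exact (List.nodup_cons.1 hl).1 hb
    have hflip : ∑ s, z s • (Y a s * (l.map fun b => Y b s).prod) =
        ∑ s, z s • (star (Y a s) * (l.map fun b => Y b s).prod) := by
      rw [← (Equiv.sum_comp (hρ a).toPerm)]
      refine Finset.sum_congr rfl fun s _ => ?_
      simp only [Function.Involutive.coe_toPerm, hP, hz, hstar]
    -- The sum is added to its image under the involution, and `q + q* = 2 re q` makes the first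
    -- factor scalar.
    have hsum : (2 : ℂ) • ∑ s, z s • (Y a s * (l.map fun b => Y b s).prod) =
        (2 : ℂ) • ∑ s, (z s * (Y a s).re) • (l.map fun b => Y b s).prod := by
      nth_rewrite 1 [two_smul]
      nth_rewrite 2 [hflip]
      rw [← Finset.sum_add_distrib, Finset.smul_sum]
      refine Finset.sum_congr rfl fun s _ => ?_
      rw [← smul_add, ← add_mul, self_add_star_eq, smul_mul_assoc, one_mul, smul_smul, smul_smul]
      congr 1
      ring
    have h2 := smul_right_injective QC (two_ne_zero (α := ℂ)) hsum
    simp only [List.map_cons, List.prod_cons]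
    rw [h2, ih (List.nodup_cons.1 hl).2 (fun s => z s * (Y a s).re)
      (fun b s => by simp only [hz, hre])]
    simp only [mul_assoc]

/-- The permutation `σ` with the cycle of `a` reversed. -/
def reverseCycleAt {α : Type*} [Fintype α] [DecidableEq α] (σ : Perm α) (a : α) : Perm α :=
  σ * (σ.cycleOf a)⁻¹ ^ 2

/-! ### Reversing one cycle of a permutation -/

section ReverseCycle

variable {α : Type*} [Fintype α] [DecidableEq α] (σ : Perm α) (a : α)

lemma reverseCycleAt_apply_of_sameCycle {b : α} (h : σ.SameCycle a b) :
    reverseCycleAt σ a b = σ⁻¹ b := by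
  have key : ∀ c, σ.SameCycle a c → (σ.cycleOf a)⁻¹ c = σ⁻¹ c := by
    intro c hc
    rw [Perm.cycleOf_inv]
    exact Perm.SameCycle.cycleOf_apply (Perm.sameCycle_inv.2 hc)
  rw [reverseCycleAt, pow_two, Perm.mul_apply, Perm.mul_apply, key b h,
    key (σ⁻¹ b) (Perm.sameCycle_symm_apply_right.2 h)]
  exact σ.apply_symm_apply _

lemma reverseCycleAt_apply_of_not_sameCycle {b : α} (h : ¬ σ.SameCycle a b) :
    reverseCycleAt σ a b = σ b := by
  have key : (σ.cycleOf a)⁻¹ b = b := by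
    rw [Perm.inv_eq_iff_eq, Perm.cycleOf_apply_of_not_sameCycle h]
  rw [reverseCycleAt, pow_two, Perm.mul_apply, Perm.mul_apply, key, key]

lemma reverseCycleAt_pow_apply_of_sameCycle {b : α} (h : σ.SameCycle a b) (n : ℕ) :
    (reverseCycleAt σ a ^ n) b = (σ⁻¹ ^ n) b := by
  induction n with
  | zero => rfl
  | succ n ih =>
    rw [pow_succ', Perm.mul_apply, ih, pow_succ', Perm.mul_apply,
      reverseCycleAt_apply_of_sameCycle]
    rw [inv_pow, ← zpow_natCast, ← zpow_neg]
    exact Perm.sameCycle_zpow_right.2 h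

lemma reverseCycleAt_pow_apply_of_not_sameCycle {b : α} (h : ¬ σ.SameCycle a b) (n : ℕ) :
    (reverseCycleAt σ a ^ n) b = (σ ^ n) b := by
  induction n with
  | zero => rfl
  | succ n ih =>
    rw [pow_succ', Perm.mul_apply, ih, pow_succ', Perm.mul_apply,
      reverseCycleAt_apply_of_not_sameCycle]
    exact fun h' => h (Perm.sameCycle_pow_right.1 h')

lemma sameCycle_reverseCycleAt {x y : α} :
    (reverseCycleAt σ a).SameCycle x y ↔ σ.SameCycle x y := by
  by_cases hx : σ.SameCycle a x
  · constructor
    · intro h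
      obtain ⟨n, rfl⟩ := h.exists_nat_pow_eq
      rw [reverseCycleAt_pow_apply_of_sameCycle σ a hx, inv_pow, ← zpow_natCast, ← zpow_neg]
      exact Perm.sameCycle_zpow_right.2 (Perm.SameCycle.refl σ x)
    · intro h
      obtain ⟨n, rfl⟩ := h.exists_nat_pow_eq
      refine Perm.SameCycle.symm ⟨n, ?_⟩
      rw [zpow_natCast, reverseCycleAt_pow_apply_of_sameCycle σ a (hx.trans h), inv_pow,
        Perm.inv_eq_iff_eq]
  · constructor
    · intro h
      obtain ⟨n, rfl⟩ := h.exists_nat_pow_eq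
      rw [reverseCycleAt_pow_apply_of_not_sameCycle σ a hx]
      exact Perm.sameCycle_pow_right.2 (Perm.SameCycle.refl σ x)
    · intro h
      obtain ⟨n, rfl⟩ := h.exists_nat_pow_eq
      exact ⟨n, by rw [zpow_natCast, reverseCycleAt_pow_apply_of_not_sameCycle σ a hx]⟩

lemma reverseCycleAt_reverseCycleAt : reverseCycleAt (reverseCycleAt σ a) a = σ := by
  ext b
  by_cases h : σ.SameCycle a b
  · rw [reverseCycleAt_apply_of_sameCycle _ _ ((sameCycle_reverseCycleAt σ a).2 h),
      Perm.inv_eq_iff_eq, reverseCycleAt_apply_of_sameCycle _ _ (Perm.sameCycle_apply_right.2 h)]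
    exact (σ.symm_apply_apply b).symm
  · rw [reverseCycleAt_apply_of_not_sameCycle _ _ (mt (sameCycle_reverseCycleAt σ a).1 h),
      reverseCycleAt_apply_of_not_sameCycle _ _ h]

/-- The two permutations differ by a square, which is even. -/
lemma sign_reverseCycleAt : Perm.sign (reverseCycleAt σ a) = Perm.sign σ := by
  simp [reverseCycleAt]

lemma isCycleMax_reverseCycleAt {n : ℕ} (σ : Perm (Fin n)) (a b : Fin n) :
    IsCycleMax (reverseCycleAt σ a) b ↔ IsCycleMax σ b := by
  simp only [IsCycleMax, sameCycle_reverseCycleAt]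

lemma minimalPeriod_reverseCycleAt (b : α) :
    Function.minimalPeriod (reverseCycleAt σ a) b = Function.minimalPeriod σ b := by
  rw [Function.minimalPeriod_eq_minimalPeriod_iff]
  intro n
  simp only [Function.IsPeriodicPt, Function.IsFixedPt, Perm.iterate_eq_pow]
  by_cases h : σ.SameCycle a b
  · rw [reverseCycleAt_pow_apply_of_sameCycle σ a h, inv_pow, Perm.inv_eq_iff_eq, eq_comm]
  · rw [reverseCycleAt_pow_apply_of_not_sameCycle σ a h]

end ReverseCycle

lemma star_prod_range {R : Type*} [Ring R] [StarRing R] (F : ℕ → R) (p : ℕ) :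
    star ((List.range p).map F).prod =
      ((List.range p).map fun j => star (F (p - 1 - j))).prod := by
  induction p with
  | zero => simp
  | succ p ih =>
    rw [List.range_succ, List.map_append, List.prod_append, star_mul, ih, ← List.range_succ,
      List.range_succ_eq_map]
    simp only [List.map_cons, List.map_nil, List.prod_cons, List.prod_nil, mul_one, List.map_map,
      Function.comp_def]
    congr 3
    funext j
    congr 2
    omega

variable {n : ℕ}

lemma cycleFactor_of_isCycleMax (X : Matrix (Fin n) (Fin n) QC) {σ : Perm (Fin n)} {a : Fin n}
    (h : IsCycleMax σ a) : cycleFactor X σ a =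
      ((List.range (Function.minimalPeriod σ a)).map
        fun j => X ((σ ^ j) a) ((σ ^ (j + 1)) a)).prod := by
  exact if_pos h

lemma cycleFactor_of_not_isCycleMax (X : Matrix (Fin n) (Fin n) QC) {σ : Perm (Fin n)}
    {a : Fin n} (h : ¬ IsCycleMax σ a) : cycleFactor X σ a = 1 := by
  exact if_neg h

/-- The reversed cycle reads the same entries backwards and transposed. Self-duality stars each
entry, and `star` reverses the order of products. -/
lemma cycleFactor_reverseCycleAt_self (X : Matrix (Fin n) (Fin n) QC)
    (hX : ∀ i j, X j i = star (X i j)) {σ : Perm (Fin n)} {a : Fin n} (h : IsCycleMax σ a) :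
    cycleFactor X (reverseCycleAt σ a) a = star (cycleFactor X σ a) := by
  rw [cycleFactor_of_isCycleMax X h,
    cycleFactor_of_isCycleMax X ((isCycleMax_reverseCycleAt σ a a).2 h),
    minimalPeriod_reverseCycleAt, star_prod_range]
  congr 1
  refine List.map_congr_left fun j hj => ?_
  have hj' := List.mem_range.1 hj
  rw [← hX, reverseCycleAt_pow_apply_of_sameCycle σ a (Perm.SameCycle.refl σ a),
    reverseCycleAt_pow_apply_of_sameCycle σ a (Perm.SameCycle.refl σ a)]
  -- Going back `i` steps on a cycle is going forward period minus `i` steps.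
  have key : ∀ i ≤ Function.minimalPeriod σ a,
      (σ⁻¹ ^ i) a = (σ ^ (Function.minimalPeriod σ a - i)) a := by
    intro i hi
    rw [inv_pow, Perm.inv_eq_iff_eq, ← Perm.mul_apply, ← pow_add, Nat.add_sub_cancel' hi,
      pow_minimalPeriod_apply]
  rw [key j hj'.le, key (j + 1) hj']
  congr 3 <;> omega

/-- Distinct maxima belong to distinct cycles, so the reversal does not touch the cycle that starts
at `b`. -/
lemma cycleFactor_reverseCycleAt_of_ne (X : Matrix (Fin n) (Fin n) QC) {σ : Perm (Fin n)}
    {a b : Fin n} (ha : IsCycleMax σ a) (hab : b ≠ a) :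
    cycleFactor X (reverseCycleAt σ a) b = cycleFactor X σ b := by
  by_cases hb : IsCycleMax σ b
  · rw [cycleFactor_of_isCycleMax X hb,
      cycleFactor_of_isCycleMax X ((isCycleMax_reverseCycleAt σ a b).2 hb),
      minimalPeriod_reverseCycleAt]
    have hs : ¬ σ.SameCycle a b := fun h => hab (ha.eq hb h).symm
    simp only [reverseCycleAt_pow_apply_of_not_sameCycle σ a hs]
  · rw [cycleFactor_of_not_isCycleMax X hb,
      cycleFactor_of_not_isCycleMax X (mt (isCycleMax_reverseCycleAt σ a b).1 hb)]

open scoped Classical in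
/-- The Moore-Dyson determinant of a self-dual matrix is the complex number obtained by replacing
every cycle product by its scalar part. -/
lemma mooreDet_eq_sum_prod_re (X : Matrix (Fin n) (Fin n) QC) (hX : ∀ i j, X j i = star (X i j)) :
    mooreDet X = ((∑ σ : Perm (Fin n), ((Perm.sign σ : ℤ) : ℂ) *
      ∏ a, (cycleFactor X σ a).re : ℂ) : QC) := by
  have h := sum_smul_prod_eq_sum_prod_re (S := Perm (Fin n)) (fun a σ => cycleFactor X σ a)
    -- A cycle is reversed only through its maximum; otherwise the factor of another index would
    -- change. For the remaining `a` the factor is `1`, which is its own dual.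
    (fun a σ => if IsCycleMax σ a then reverseCycleAt σ a else σ)
    (by
      intro a σ
      by_cases ha : IsCycleMax σ a
      · simp only [if_pos ha, if_pos ((isCycleMax_reverseCycleAt σ a a).2 ha),
          reverseCycleAt_reverseCycleAt]
      · simp only [if_neg ha])
    (by
      intro a b σ hb
      by_cases ha : IsCycleMax σ a
      · simp only [if_pos ha, cycleFactor_reverseCycleAt_of_ne X ha hb]
      · simp only [if_neg ha])
    (by
      intro a σ
      by_cases ha : IsCycleMax σ a
      · simp only [if_pos ha, cycleFactor_reverseCycleAt_self X hX ha]
      · simp only [if_neg ha, cycleFactor_of_not_isCycleMax X ha, star_one])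
    (List.finRange n).reverse (List.nodup_reverse.2 (List.nodup_finRange n))
    (fun σ => ((Perm.sign σ : ℤ) : ℂ))
    (by
      intro a σ
      by_cases ha : IsCycleMax σ a
      · simp only [if_pos ha, sign_reverseCycleAt]
      · simp only [if_neg ha])
  have hprod : ∀ g : Fin n → ℂ, ((List.finRange n).reverse.map g).prod = ∏ a, g a := by
    intro g
    rw [List.map_reverse, List.prod_reverse, ← List.ofFn_eq_map, List.prod_ofFn]
  simp only [hprod] at h
  rw [← h, mooreDet]
  refine Finset.sum_congr rfl fun σ _ => ?_
  rw [smul_eq_coe_mul]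
  congr 1

end MooreDeterminant

/-! ### Sums over injective functions -/

section InjectiveSums

open Equiv

open scoped Classical in
/-- `n!` times the `n`-th elementary symmetric function of `lam`. -/
def injSum {r : ℕ} (lam : Fin r → ℂ) (n : ℕ) : ℂ :=
  ∑ f : Fin n → Fin r, if Function.Injective f then ∏ j, lam (f j) else 0

variable {r : ℕ} (lam : Fin r → ℂ)

lemma injSum_zero : injSum lam 0 = 1 := by
  simp [injSum, Function.injective_of_subsingleton]

lemma injSum_eq_zero {n : ℕ} (h : r < n) : injSum lam n = 0 := by
  refine Finset.sum_eq_zero fun f _ => if_neg fun hf => ?_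
  have := Fintype.card_le_of_injective f hf
  simp only [Fintype.card_fin] at this
  omega

lemma injSum_mul_left (z : ℂ) (n : ℕ) : injSum (fun k => z * lam k) n = z ^ n * injSum lam n := by
  simp only [injSum, Finset.mul_sum, Finset.prod_mul_distrib, Finset.prod_const, Finset.card_univ,
    Fintype.card_fin, mul_ite, mul_zero]

lemma card_injective_image_eq {n : ℕ} (s : Finset (Fin r)) (hs : s.card = n) [DecidableEq (Fin r)]
    [DecidablePred fun f : Fin n → Fin r => Function.Injective f] :
    (Finset.univ.filter fun f : Fin n → Fin r =>
      Function.Injective f ∧ Finset.univ.image f = s).card = n.factorial := by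
  have h := Fintype.card_embedding_eq (α := Fin n) (β := s)
  rw [Fintype.card_fin, Fintype.card_coe, hs, Nat.descFactorial_self] at h
  rw [← h, ← Finset.card_univ]
  symm
  refine Finset.card_bij (fun (e : Fin n ↪ s) _ j => (e j : Fin r)) ?_ ?_ ?_
  · intro e _
    have he : Function.Injective fun j => (e j : Fin r) :=
      Subtype.val_injective.comp e.injective
    refine Finset.mem_filter.2 ⟨Finset.mem_univ _, he, ?_⟩
    refine Finset.eq_of_subset_of_card_le ?_ ?_
    · intro x hx
      obtain ⟨j, _, rfl⟩ := Finset.mem_image.1 hx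
      exact (e j).2
    · rw [Finset.card_image_of_injective _ he, hs, Finset.card_univ, Fintype.card_fin]
  · intro e _ e' _ hee
    ext j
    exact congrArg _ (congrFun hee j)
  · intro f hf
    obtain ⟨hf, him⟩ := (Finset.mem_filter.1 hf).2
    exact ⟨⟨fun j => ⟨f j, him ▸ Finset.mem_image_of_mem f (Finset.mem_univ j)⟩,
      fun i j hij => hf (congrArg Subtype.val hij)⟩, Finset.mem_univ _, rfl⟩

/-- Injections are grouped by their image `s`; each `s` is the image of `n!` of them, and the
product depends on `s` only. -/
lemma injSum_eq_factorial_mul (n : ℕ) :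
    injSum lam n = n.factorial * ∑ s ∈ Finset.univ.powersetCard n, ∏ k ∈ s, lam k := by
  classical
  rw [injSum, ← Finset.sum_filter, ← Finset.sum_fiberwise_of_maps_to
    (t := Finset.univ.powersetCard n) (g := fun f : Fin n → Fin r => Finset.univ.image f),
    Finset.mul_sum]
  · refine Finset.sum_congr rfl fun s hs => ?_
    have hs' := (Finset.mem_powersetCard.1 hs).2
    rw [Finset.filter_filter, ← card_injective_image_eq s hs', ← nsmul_eq_mul]
    refine (Finset.sum_congr rfl fun f hf => ?_).trans (Finset.sum_const _)
    obtain ⟨hinj, rfl⟩ := (Finset.mem_filter.1 hf).2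
    rw [Finset.prod_image fun _ _ _ _ h => hinj h]
  · intro f hf
    refine Finset.mem_powersetCard.2 ⟨Finset.subset_univ _, ?_⟩
    rw [Finset.card_image_of_injective _ (Finset.mem_filter.1 hf).2, Finset.card_univ,
      Fintype.card_fin]

lemma sum_injSum_div_factorial :
    ∑ n ∈ Finset.range (r + 1), ((n.factorial : ℂ)⁻¹) * injSum lam n = ∏ k, (1 + lam k) := by
  rw [Finset.prod_one_add, Finset.sum_powerset, Finset.card_univ, Fintype.card_fin]
  refine Finset.sum_congr rfl fun n _ => ?_
  rw [injSum_eq_factorial_mul, ← mul_assoc, inv_mul_cancel₀, one_mul]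
  exact_mod_cast n.factorial_ne_zero

/-- This is the expansion of `n! eₙ` in power sums. For a fixed labelling `f` the signed sum is a
determinant: its matrix is diagonal if `f` is injective and has two equal columns otherwise. -/
lemma sum_sign_mul_sum_diagonal (n : ℕ) :
    ∑ σ : Perm (Fin n), ((Perm.sign σ : ℤ) : ℂ) *
      ∑ f : Fin n → Fin r, ∏ j, Matrix.diagonal lam (f j) (f (σ j)) = injSum lam n := by
  simp_rw [Finset.mul_sum]
  rw [Finset.sum_comm, injSum]
  refine Finset.sum_congr rfl fun f _ => ?_
  have hdet := Matrix.det_apply'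
    (Matrix.of fun p q : Fin n => Matrix.diagonal lam (f q) (f p))
  simp only [Matrix.of_apply] at hdet
  rw [← hdet]
  split_ifs with hf
  · have : (Matrix.of fun p q : Fin n => Matrix.diagonal lam (f q) (f p)) =
        Matrix.diagonal fun j => lam (f j) := by
      ext p q
      by_cases h : p = q
      · subst h; simp
      · rw [Matrix.diagonal_apply_ne _ h, Matrix.of_apply,
          Matrix.diagonal_apply_ne _ fun h' => h (hf h').symm]
    rw [this, Matrix.det_diagonal]
  · simp only [Function.Injective, not_forall] at hf
    obtain ⟨p, q, hpq, hne⟩ := hf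
    exact Matrix.det_zero_of_column_eq hne fun k => by simp [hpq]

end InjectiveSums

/-! ### A primitive idempotent of the complexified quaternions -/

/-- The idempotent `(1 + √-1 i) / 2`. -/
def proj : QC := ⟨1 / 2, Complex.I / 2, 0, 0⟩

/-- The quaternion `j`. -/
def unitJ : QC := ⟨0, 0, 1, 0⟩

section Idempotent

@[simp] lemma re_proj : proj.re = 1 / 2 := rfl
@[simp] lemma imI_proj : proj.imI = Complex.I / 2 := rfl
@[simp] lemma imJ_proj : proj.imJ = 0 := rfl
@[simp] lemma imK_proj : proj.imK = 0 := rfl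
@[simp] lemma re_unitJ : unitJ.re = 0 := rfl
@[simp] lemma imI_unitJ : unitJ.imI = 0 := rfl
@[simp] lemma imJ_unitJ : unitJ.imJ = 1 := rfl
@[simp] lemma imK_unitJ : unitJ.imK = 0 := rfl

lemma proj_mul_proj : proj * proj = proj := by
  ext <;> simp <;> ring_nf
  simp
  ring

/-- Primitivity of the idempotent: the corner `proj * QC * proj` is one-dimensional. The factor 2
compensates for `proj.re = 1 / 2`. -/
lemma proj_mul_mul_proj (q : QC) : proj * q * proj = (2 * (q * proj).re) • proj := by
  ext <;> simp <;> ring_nf <;> simp <;> ring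

lemma star_proj_mul_unitJ : star proj * unitJ = unitJ * proj := by
  ext <;> simp

lemma unitJ_mul_unitJ : unitJ * unitJ = -1 := by
  ext <;> simp

lemma proj_mul_unitJ_mul_proj : proj * unitJ * proj = 0 := by
  rw [proj_mul_mul_proj]
  simp

lemma star_unitJ : star unitJ = -unitJ := by
  ext <;> simp

/-- Here `-j * proj * j` is the complementary idempotent `star proj`, so this is a resolution of the
identity through `proj` alone. -/
lemma proj_sub_unitJ_mul_proj_mul_unitJ : proj - unitJ * proj * unitJ = 1 := by
  ext <;> simp
  ring

/-- A product of an element of `proj * QC` and one of `QC * proj` is a multiple of `proj`. -/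
lemma mul_eq_smul_proj {p q : QC} (hp : proj * p = p) (hq : q * proj = q) :
    p * q = (2 * (p * q).re) • proj := by
  have h := proj_mul_mul_proj (p * q)
  rwa [← mul_assoc proj, hp, mul_assoc, hq] at h

/-- The right ideal `proj * QC` is two-dimensional with basis `proj`, `proj * j`; this is where the
pairs of coordinates of the operator come from. -/
lemma eq_smul_proj_add {p : QC} (hp : proj * p = p) :
    p = (2 * p.re) • proj + (2 * (p * -unitJ).re) • (proj * unitJ) := by
  rw [← hp]
  ext <;> simp <;> ring_nf <;> simp <;> ring

/-- Nondegeneracy of the trace form, tested on the basis `1`, `proj`, `j`, `proj * j`. -/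
lemma eq_zero_of_re_mul_eq_zero {q : QC} (h : ∀ p, (q * p).re = 0) : q = 0 := by
  have h1 := h 1
  have h2 := h proj
  have h3 := h unitJ
  have h4 := h (proj * unitJ)
  simp at h1 h2 h3 h4
  simp [h1, h3] at h2 h4
  ext <;> simp [h1, h2, h3, h4]

end Idempotent

/-! ### Integration of quaternion functions -/

section Integration

/-- The scalar part as a continuous linear map. -/
def reL : QC →L[ℂ] ℂ :=
  LinearMap.toContinuousLinearMap (QuaternionAlgebra.reₗ (-1 : ℂ) 0 (-1))

/-- The embedding of the scalars as a continuous linear map. -/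
def coeL : ℂ →L[ℂ] QC := LinearMap.toContinuousLinearMap (Algebra.linearMap ℂ QC)

/-- Left multiplication as a continuous linear map. -/
def mulLeftL (q : QC) : QC →L[ℂ] QC := LinearMap.toContinuousLinearMap (LinearMap.mulLeft ℂ q)

/-- Right multiplication as a continuous linear map. -/
def mulRightL (q : QC) : QC →L[ℂ] QC := LinearMap.toContinuousLinearMap (LinearMap.mulRight ℂ q)

/-- Quaternion conjugation as a continuous linear map. -/
def starL : QC →L[ℂ] QC := LinearMap.toContinuousLinearMap
  { toFun := star
    map_add' := star_add
    map_smul' := fun c q => by ext <;> simp }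


variable {Λ : Type*} [MeasurableSpace Λ] {μ : Measure Λ}

lemma integrable_const_mul {f : Λ → QC} (hf : Integrable f μ) (q : QC) :
    Integrable (fun x => q * f x) μ :=
  (mulLeftL q).integrable_comp hf

lemma integrable_mul_const {f : Λ → QC} (hf : Integrable f μ) (q : QC) :
    Integrable (fun x => f x * q) μ :=
  (mulRightL q).integrable_comp hf

lemma integral_const_mul' {f : Λ → QC} (hf : Integrable f μ) (q : QC) :
    ∫ x, q * f x ∂μ = q * ∫ x, f x ∂μ :=
  (mulLeftL q).integral_comp_comm hf

lemma integral_mul_const' {f : Λ → QC} (hf : Integrable f μ) (q : QC) :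
    ∫ x, f x * q ∂μ = (∫ x, f x ∂μ) * q :=
  (mulRightL q).integral_comp_comm hf

lemma integral_re {f : Λ → QC} (hf : Integrable f μ) : ∫ x, (f x).re ∂μ = (∫ x, f x ∂μ).re :=
  reL.integral_comp_comm hf

lemma integrable_re {f : Λ → QC} (hf : Integrable f μ) : Integrable (fun x => (f x).re) μ :=
  reL.integrable_comp hf

lemma integrable_coe {f : Λ → ℂ} (hf : Integrable f μ) : Integrable (fun x => (f x : QC)) μ :=
  coeL.integrable_comp hf

lemma integral_coe {f : Λ → ℂ} (hf : Integrable f μ) :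
    ∫ x, (f x : QC) ∂μ = ((∫ x, f x ∂μ : ℂ) : QC) :=
  coeL.integral_comp_comm hf

lemma aestronglyMeasurable_const_mul {f : Λ → QC} (hf : AEStronglyMeasurable f μ) (q : QC) :
    AEStronglyMeasurable (fun x => q * f x) μ :=
  (mulLeftL q).continuous.comp_aestronglyMeasurable hf

lemma aestronglyMeasurable_mul_const {f : Λ → QC} (hf : AEStronglyMeasurable f μ) (q : QC) :
    AEStronglyMeasurable (fun x => f x * q) μ :=
  (mulRightL q).continuous.comp_aestronglyMeasurable hf

lemma aestronglyMeasurable_star {f : Λ → QC} (hf : AEStronglyMeasurable f μ) :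
    AEStronglyMeasurable (fun x => star (f x)) μ :=
  starL.continuous.comp_aestronglyMeasurable hf

lemma integrable_star {f : Λ → QC} (hf : Integrable f μ) : Integrable (fun x => star (f x)) μ :=
  starL.integrable_comp hf

end Integration

/-! ### Factorizations of a finite-rank kernel over the complex numbers -/

section Factorization

variable {Λ : Type*}

/-- The matrix `m` with `bᵢ(x) aⱼ(x) = mᵢⱼ(x) proj`. -/
def pairing {N : ℕ} (a b : Fin N → Λ → QC) (x : Λ) : Matrix (Fin N) (Fin N) ℂ :=
  Matrix.of fun i j => 2 * (b i x * a j x).re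

variable {K : Λ → Λ → QC} {N : ℕ} {a b : Fin N → Λ → QC}

lemma mul_eq_pairing_smul (ha : ∀ i x, a i x * proj = a i x) (hb : ∀ i x, proj * b i x = b i x)
    (x : Λ) (i j : Fin N) : b i x * a j x = pairing a b x i j • proj :=
  mul_eq_smul_proj (hb i x) (ha j x)

/-- Each inner pair `bᵢ aⱼ` at a common point collapses to a complex number, so only the two
outermost quaternions survive. -/
lemma prod_sum_mul (ha : ∀ i x, a i x * proj = a i x) (hb : ∀ i x, proj * b i x = b i x)
    (y : ℕ → Λ) (p : ℕ) :
    ((List.range (p + 1)).map fun t => ∑ i, a i (y t) * b i (y (t + 1))).prod =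
      ∑ i, ∑ j, ((List.range p).map fun t => pairing a b (y (t + 1))).prod i j •
        (a i (y 0) * b j (y (p + 1))) := by
  induction p with
  | zero => simp [Matrix.one_apply]
  | succ p ih =>
    rw [List.range_succ, List.map_append, List.prod_append, ih]
    simp only [List.map_cons, List.map_nil, List.prod_cons, List.prod_nil, mul_one]
    rw [Finset.sum_mul]
    refine Finset.sum_congr rfl fun i _ => ?_
    rw [List.range_succ, List.map_append, List.prod_append, Finset.sum_mul]
    simp only [List.map_cons, List.map_nil, List.prod_cons, List.prod_nil, mul_one,
      Matrix.mul_apply, Finset.mul_sum, Finset.sum_smul]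
    rw [Finset.sum_comm]
    refine Finset.sum_congr rfl fun k _ => Finset.sum_congr rfl fun j _ => ?_
    rw [smul_mul_assoc, mul_assoc, ← mul_assoc (b j _), mul_eq_pairing_smul ha hb, smul_mul_assoc,
      hb, mul_smul_comm, smul_smul]

/-- On a closed path, cyclicity of the scalar part brings the outer factors together. They supply
the missing matrix, with a factor 1/2 from the normalization of `pairing`. -/
lemma re_prod_sum_mul (ha : ∀ i x, a i x * proj = a i x) (hb : ∀ i x, proj * b i x = b i x)
    (y : ℕ → Λ) (p : ℕ) (hp : p ≠ 0) (hy : y p = y 0) :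
    ((List.range p).map fun t => ∑ i, a i (y t) * b i (y (t + 1))).prod.re =
      1 / 2 * ((List.range p).map fun t => pairing a b (y t)).prod.trace := by
  obtain ⟨q, rfl⟩ := Nat.exists_eq_succ_of_ne_zero hp
  rw [Nat.succ_eq_add_one] at hy ⊢
  rw [prod_sum_mul ha hb, List.range_succ_eq_map, List.map_cons, List.prod_cons, List.map_map,
    Matrix.trace_mul_comm, hy, re_sum, Matrix.trace, Finset.mul_sum]
  refine Finset.sum_congr rfl fun i _ => ?_
  rw [re_sum, Matrix.diag_apply, Matrix.mul_apply, Finset.mul_sum]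
  refine Finset.sum_congr rfl fun j _ => ?_
  have h : pairing a b (y 0) j i = 2 * (b j (y 0) * a i (y 0)).re := rfl
  rw [h, re_smul, re_mul_comm]
  simp only [Function.comp_def, Nat.succ_eq_add_one]
  ring

open scoped Classical in
lemma re_cycleFactor (ha : ∀ i x, a i x * proj = a i x) (hb : ∀ i x, proj * b i x = b i x)
    {S : Set Λ} (hK : ∀ x ∈ S, ∀ y ∈ S, K x y = ∑ i, a i x * b i y) {n : ℕ} (x : Fin n → Λ)
    (hx : ∀ i, x i ∈ S) (σ : Equiv.Perm (Fin n)) (c : Fin n) :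
    (cycleFactor (Matrix.of fun i j => K (x i) (x j)) σ c).re =
      (if IsCycleMax σ c then (1 / 2 : ℂ) else 1) * (if IsCycleMax σ c then
        (((List.range (Function.minimalPeriod σ c)).map
          fun j => pairing a b (x ((σ ^ j) c))).prod).trace else 1) := by
  by_cases hc : IsCycleMax σ c
  · rw [cycleFactor_of_isCycleMax _ hc, if_pos hc, if_pos hc]
    simp only [Matrix.of_apply, hK _ (hx _) _ (hx _)]
    exact re_prod_sum_mul ha hb (fun t => x ((σ ^ t) c)) _ (minimalPeriod_perm_pos σ c).ne'
      (by rw [pow_minimalPeriod_apply, pow_zero, Equiv.Perm.one_apply])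
  · rw [cycleFactor_of_not_isCycleMax _ hc, if_neg hc, if_neg hc]
    simp

open scoped Classical in
/-- The factor `2^(-c)`, where `c` is the number of cycles of `σ`. -/
def cycleWeight {n : ℕ} (σ : Equiv.Perm (Fin n)) : ℂ :=
  ∏ c, if IsCycleMax σ c then (1 / 2 : ℂ) else 1

/-- All factors are now complex and each one depends on a single point, which is the form needed for
Fubini. -/
lemma mooreDet_kernel (hself : ∀ x y, K y x = star (K x y))
    (ha : ∀ i x, a i x * proj = a i x) (hb : ∀ i x, proj * b i x = b i x)
    {S : Set Λ} (hK : ∀ x ∈ S, ∀ y ∈ S, K x y = ∑ i, a i x * b i y) {n : ℕ} (x : Fin n → Λ)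
    (hx : ∀ i, x i ∈ S) :
    mooreDet (Matrix.of fun i j => K (x i) (x j)) =
      ((∑ σ : Equiv.Perm (Fin n), ((Equiv.Perm.sign σ : ℤ) : ℂ) * (cycleWeight σ *
        ∑ i : Fin n → Fin N, ∏ j, pairing a b (x j) (i j) (i (σ j))) : ℂ) : QC) := by
  refine (mooreDet_eq_sum_prod_re (Matrix.of fun i j => K (x i) (x j))
    fun i j => hself (x i) (x j)).trans ?_
  congr 1
  refine Finset.sum_congr rfl fun σ _ => ?_
  simp only [re_cycleFactor ha hb hK x hx]
  rw [Finset.prod_mul_distrib, prod_trace_cycles (fun j => pairing a b (x j)) σ, cycleWeight]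

/-- A cycle of length `l` contributes `tr(Gˡ) / 2`, which is the trace of the `l`-th power of the
diagonal matrix of `lam`. -/
lemma cycleWeight_mul_sum {r : ℕ} (G : Matrix (Fin N) (Fin N) ℂ) (lam : Fin r → ℂ)
    (hG : ∀ l, (G ^ l).trace = 2 * ∑ k, lam k ^ l) {n : ℕ} (σ : Equiv.Perm (Fin n)) :
    cycleWeight σ * ∑ i : Fin n → Fin N, ∏ j, G (i j) (i (σ j)) =
      ∑ f : Fin n → Fin r, ∏ j, Matrix.diagonal lam (f j) (f (σ j)) := by
  classical
  rw [← prod_trace_cycles (fun _ => G), ← prod_trace_cycles (fun _ => Matrix.diagonal lam),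
    cycleWeight, ← Finset.prod_mul_distrib]
  refine Finset.prod_congr rfl fun c _ => ?_
  split_ifs with hc
  · simp only [List.map_const', List.prod_replicate, List.length_range, hG, Matrix.diagonal_pow,
      Matrix.trace_diagonal, Pi.pow_apply]
    ring
  · rw [one_mul]

/-- `K (x, y) = ∑ₖ aₖ(x) bₖ(y)` almost everywhere, where `aₖ` takes values in `QC * proj` and `bₖ`
in `proj * QC`, so that the products `bₖ aₗ` are complex multiples of `proj`. -/
structure IsFactorization [MeasurableSpace Λ] (μ : Measure Λ) (K : Λ → Λ → QC) {N : ℕ} (a b : Fin N → Λ → QC) :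
    Prop where
  aesm_left : ∀ i, AEStronglyMeasurable (a i) μ
  aesm_right : ∀ i, AEStronglyMeasurable (b i) μ
  left_mul_proj : ∀ i x, a i x * proj = a i x
  proj_mul_right : ∀ i x, proj * b i x = b i x
  integrable_mul : ∀ i j, Integrable (fun x => b i x * a j x) μ
  exists_eq : ∃ S ∈ ae μ, ∀ x ∈ S, ∀ y ∈ S, K x y = ∑ i, a i x * b i y

/-- The matrix of the integrals of `pairing a b`. -/
def gram [MeasurableSpace Λ] (μ : Measure Λ) {N : ℕ} (a b : Fin N → Λ → QC) : Matrix (Fin N) (Fin N) ℂ :=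
  Matrix.of fun i j => ∫ x, pairing a b x i j ∂μ

variable [MeasurableSpace Λ] {μ : Measure Λ}

lemma integrable_pairing (h : IsFactorization μ K a b) (i j : Fin N) :
    Integrable (fun x => pairing a b x i j) μ :=
  (integrable_re (h.integrable_mul i j)).const_mul 2

/-- The integrals in the Fredholm expansion of a self-dual finite-rank kernel. -/
theorem integral_mooreDet_kernel [SigmaFinite μ] (hself : ∀ x y, K y x = star (K x y))
    (h : IsFactorization μ K a b) {r : ℕ} (lam : Fin r → ℂ)
    (hG : ∀ l, (gram μ a b ^ l).trace = 2 * ∑ k, lam k ^ l) (n : ℕ) :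
    Integrable (fun x : Fin n → Λ => mooreDet (Matrix.of fun i j => K (x i) (x j)))
      (Measure.pi fun _ => μ) ∧
    ∫ x : Fin n → Λ, mooreDet (Matrix.of fun i j => K (x i) (x j)) ∂(Measure.pi fun _ => μ) =
      (injSum lam n : QC) := by
  obtain ⟨S, hS, hK⟩ := h.exists_eq
  have hae : (fun x : Fin n → Λ => mooreDet (Matrix.of fun i j => K (x i) (x j)))
      =ᵐ[Measure.pi fun _ => μ] fun x =>
        ((∑ σ : Equiv.Perm (Fin n), ((Equiv.Perm.sign σ : ℤ) : ℂ) * (cycleWeight σ *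
          ∑ i : Fin n → Fin N, ∏ j, pairing a b (x j) (i j) (i (σ j))) : ℂ) : QC) := by
    have hmem : ∀ᵐ x : Fin n → Λ ∂(Measure.pi fun _ => μ), ∀ i, x i ∈ S :=
      eventually_all.2 fun i => (Measure.tendsto_eval_ae_ae (μ := fun _ : Fin n => μ)).eventually hS
    filter_upwards [hmem] with x hx
    exact mooreDet_kernel hself h.left_mul_proj h.proj_mul_right hK x hx
  have hi : ∀ (σ : Equiv.Perm (Fin n)) (i : Fin n → Fin N), Integrable
      (fun x : Fin n → Λ => ∏ j, pairing a b (x j) (i j) (i (σ j))) (Measure.pi fun _ => μ) :=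
    fun σ i => Integrable.fintype_prod (f := fun j x => pairing a b x (i j) (i (σ j)))
      fun j => integrable_pairing h _ _
  have hi' : ∀ σ : Equiv.Perm (Fin n), Integrable (fun x : Fin n → Λ =>
      ((Equiv.Perm.sign σ : ℤ) : ℂ) * (cycleWeight σ *
        ∑ i : Fin n → Fin N, ∏ j, pairing a b (x j) (i j) (i (σ j)))) (Measure.pi fun _ => μ) :=
    fun σ => ((integrable_finsetSum _ fun i _ => hi σ i).const_mul _).const_mul _
  have hint := integrable_finsetSum Finset.univ fun σ _ => hi' σ
  refine ⟨(integrable_coe hint).congr hae.symm, ?_⟩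
  rw [integral_congr_ae hae, integral_coe hint]
  congr 1
  rw [integral_finsetSum _ fun σ _ => hi' σ, ← sum_sign_mul_sum_diagonal]
  refine Finset.sum_congr rfl fun σ _ => ?_
  rw [integral_const_mul, integral_const_mul, integral_finsetSum _ fun i _ => hi σ i,
    ← cycleWeight_mul_sum (gram μ a b) lam hG]
  congr 2
  refine Finset.sum_congr rfl fun i _ => ?_
  exact integral_fintype_prod_eq_prod (fun j x => pairing a b x (i j) (i (σ j)))

end Factorization

/-! ### Products of two antisymmetric matrices -/

section SkewMatrices

open Matrix Module

lemma even_card_of_skew_of_det_ne_zero {n : Type*} [Fintype n] [DecidableEq n]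
    (A : Matrix n n ℂ) (hA : Aᵀ = -A) (hdet : A.det ≠ 0) : Even (Fintype.card n) := by
  by_contra h
  have h1 := Matrix.det_neg A
  rw [← hA, det_transpose, (Nat.not_even_iff_odd.1 h).neg_one_pow, neg_one_mul] at h1
  exact hdet (self_eq_neg.1 h1)

lemma mulVec_dotProduct_of_skew {n : Type*} [Fintype n] (A : Matrix n n ℂ) (hA : Aᵀ = -A)
    (x w : n → ℂ) : (A *ᵥ x) ⬝ᵥ w = -(x ⬝ᵥ (A *ᵥ w)) := by
  rw [dotProduct_mulVec, ← mulVec_transpose, hA, neg_mulVec, neg_dotProduct, neg_neg]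

/-- If the vectors `A uᵢ` form a basis of the range, then `uᵢ · A uⱼ` is an antisymmetric matrix
whose size is the rank. It is invertible, so its size is even. -/
lemma even_rank_of_skew {n : Type*} [Fintype n] [DecidableEq n] (A : Matrix n n ℂ)
    (hA : Aᵀ = -A) : Even A.rank := by
  let B := Module.finBasis ℂ (LinearMap.range A.mulVecLin)
  choose u hu using fun i => (B i).2
  replace hu : ∀ i, A *ᵥ u i = (B i : n → ℂ) := hu
  let P : Matrix (Fin (finrank ℂ (LinearMap.range A.mulVecLin)))
    (Fin (finrank ℂ (LinearMap.range A.mulVecLin))) ℂ := Matrix.of fun i j => u i ⬝ᵥ (A *ᵥ u j)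
  have hP : Pᵀ = -P := by
    ext i j
    change u j ⬝ᵥ (A *ᵥ u i) = -(u i ⬝ᵥ (A *ᵥ u j))
    rw [← mulVec_dotProduct_of_skew A hA, dotProduct_comm]
  have hdet : P.det ≠ 0 := by
    intro h0
    obtain ⟨c, hc, hPc⟩ := exists_mulVec_eq_zero_iff.2 h0
    refine hc ?_
    set w := ∑ j, c j • u j with hw
    have hAw : A *ᵥ w = ∑ j, c j • (B j : n → ℂ) := by
      rw [hw, mulVec_sum]
      exact Finset.sum_congr rfl fun j _ => by rw [mulVec_smul, hu]
    have huw : ∀ i, u i ⬝ᵥ (A *ᵥ w) = 0 := by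
      intro i
      have := congrFun hPc i
      rw [hw, mulVec_sum, dotProduct_sum]
      simp only [mulVec_smul, dotProduct_smul, smul_eq_mul]
      simpa only [mulVec, dotProduct, P, of_apply, Pi.zero_apply, mul_comm] using this
    -- By antisymmetry `x · A w = -(A x) · w`, and `A x` is a combination of the `A uᵢ`, for which
    -- this pairing vanishes by `huw`.
    have hzero : A *ᵥ w = 0 := by
      refine dotProduct_eq_zero _ fun x => ?_
      rw [dotProduct_comm, ← neg_eq_zero, ← mulVec_dotProduct_of_skew A hA]
      have hx : A *ᵥ x = ∑ i, B.repr ⟨A *ᵥ x, ⟨x, rfl⟩⟩ i • (A *ᵥ u i) := by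
        have := congrArg (Submodule.subtype _) (B.sum_repr ⟨A *ᵥ x, ⟨x, rfl⟩⟩)
        rw [map_sum] at this
        simp only [hu]
        exact this.symm
      rw [hx, sum_dotProduct]
      refine Finset.sum_eq_zero fun i _ => ?_
      rw [smul_dotProduct, mulVec_dotProduct_of_skew A hA, huw, neg_zero, smul_zero]
    rw [hAw] at hzero
    funext j
    refine Fintype.linearIndependent_iff.1 B.linearIndependent c (Subtype.ext ?_) j
    simpa using hzero
  simpa [Matrix.rank] using even_card_of_skew_of_det_ne_zero P hP hdet

lemma transpose_sub_smul_one_pow_mul {n : Type*} [Fintype n] [DecidableEq n] (γ ω : Matrix n n ℂ)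
    (hγ : γᵀ = -γ) (hω : ωᵀ = -ω) (c : ℂ) (k : ℕ) :
    ((γ * ω - c • 1) ^ k * γ)ᵀ = -((γ * ω - c • 1) ^ k * γ) := by
  have hcomm : γ * (γ * ω - c • 1)ᵀ = (γ * ω - c • 1) * γ := by
    rw [transpose_sub, transpose_mul, hγ, hω, transpose_smul, transpose_one]
    noncomm_ring
  rw [transpose_mul, hγ, transpose_pow, neg_mul]
  congr 1
  induction k with
  | zero => simp
  | succ k ih =>
    rw [pow_succ, ← mul_assoc, ih, mul_assoc, hcomm, ← mul_assoc, ← pow_succ]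

/-- The multiplicity of `c` is `N` minus the rank of `(γω - c)ᴺ`. The invertible factor `γ` does not
change this rank and makes the matrix antisymmetric; `N` is even because `γ` is invertible. -/
lemma even_rootMultiplicity_charpoly {N : ℕ} (γ ω : Matrix (Fin N) (Fin N) ℂ)
    (hγ : γᵀ = -γ) (hω : ωᵀ = -ω) (hdet : γ.det ≠ 0) (c : ℂ) :
    Even ((γ * ω).charpoly.rootMultiplicity c) := by
  have hN : Even N := by simpa using even_card_of_skew_of_det_ne_zero γ hγ hdet
  have hrank : Even ((γ * ω - c • 1) ^ N).rank := by
    rw [← rank_mul_eq_left_of_isUnit_det γ _ (isUnit_iff_ne_zero.2 hdet)]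
    exact even_rank_of_skew _ (transpose_sub_smul_one_pow_mul γ ω hγ hω c N)
  have h := LinearMap.finrank_maxGenEigenspace_eq (Matrix.toLin' (γ * ω)) c
  rw [Matrix.charpoly_toLin', Module.End.maxGenEigenspace_eq_genEigenspace_finrank,
    Module.End.genEigenspace_nat, finrank_pi, Fintype.card_fin] at h
  have h2 : (Matrix.toLin' (γ * ω) - c • 1) ^ N =
      Matrix.toLin' ((γ * ω - c • 1) ^ N) := by
    rw [Matrix.toLin'_pow, map_sub, map_smul, Matrix.toLin'_one]
    rfl
  rw [h2] at h
  have h3 := LinearMap.finrank_range_add_finrank_ker (Matrix.toLin' ((γ * ω - c • 1) ^ N))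
  rw [finrank_pi, Fintype.card_fin, h] at h3
  have h4 : finrank ℂ (LinearMap.range (Matrix.toLin' ((γ * ω - c • 1) ^ N))) =
      ((γ * ω - c • 1) ^ N).rank := rfl
  rw [h4] at h3
  rw [← h3] at hN
  exact (Nat.even_add.1 hN).1 hrank

lemma trace_pow_of_isNilpotent_sub {V : Type*} [AddCommGroup V] [Module ℂ V]
    [FiniteDimensional ℂ V] (f : End ℂ V) (c : ℂ) (hf : IsNilpotent (f - algebraMap ℂ _ c))
    (l : ℕ) : LinearMap.trace ℂ V (f ^ l) = finrank ℂ V * c ^ l := by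
  induction l with
  | zero => simp
  | succ l ih =>
    have h := LinearMap.trace_comp_eq_mul_of_commute_of_isNilpotent (f := f ^ l) (g := f) c
      (Commute.pow_self f l) hf
    rw [pow_succ]
    refine h.trans ?_
    rw [ih, pow_succ]
    ring

/-- The space is the direct sum of generalized eigenspaces, and on the one of `c` the operator is
`c` plus a nilpotent. -/
lemma trace_pow_eq_sum_roots {N : ℕ} (G : Matrix (Fin N) (Fin N) ℂ) (l : ℕ) :
    (G ^ l).trace = (G.charpoly.roots.map fun c => c ^ l).sum := by
  classical
  set f : End ℂ (Fin N → ℂ) := Matrix.toLin' G with hf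
  have hint := DirectSum.isInternal_submodule_of_iSupIndep_of_iSup_eq_top
    f.independent_maxGenEigenspace (Module.End.iSup_maxGenEigenspace_eq_top f)
  have hfin : {c | f.maxGenEigenspace c ≠ ⊥}.Finite :=
    WellFoundedGT.finite_ne_bot_of_iSupIndep f.independent_maxGenEigenspace
  have hmaps : ∀ c, Set.MapsTo (f ^ l) (f.maxGenEigenspace c) (f.maxGenEigenspace c) := fun c =>
    f.mapsTo_maxGenEigenspace_of_comm (Commute.self_pow f l) c
  have hmaps1 : ∀ c, Set.MapsTo f (f.maxGenEigenspace c) (f.maxGenEigenspace c) := fun c =>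
    f.mapsTo_maxGenEigenspace_of_comm (Commute.refl f) c
  have h1 : (G ^ l).trace = LinearMap.trace ℂ _ (f ^ l) := by
    rw [hf, ← Matrix.toLin'_pow, Matrix.trace_toLin'_eq]
  have h2 : ∀ c, LinearMap.trace ℂ _ ((f ^ l).restrict (hmaps c)) =
      G.charpoly.roots.count c * c ^ l := by
    intro c
    rw [Polynomial.count_roots, ← Matrix.charpoly_toLin' G,
      ← LinearMap.finrank_maxGenEigenspace_eq, ← Module.End.pow_restrict l (hmaps1 c)]
    refine trace_pow_of_isNilpotent_sub _ c ?_ l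
    exact f.isNilpotent_restrict_maxGenEigenspace_sub_algebraMap c
  rw [h1, LinearMap.trace_eq_sum_trace_restrict' hint hfin hmaps, Finset.sum_multiset_map_count]
  simp only [h2, nsmul_eq_mul]
  refine Finset.sum_subset_zero_on_sdiff ?_ ?_ (fun _ _ => rfl)
  · intro c hc
    rw [Multiset.mem_toFinset, ← Multiset.count_pos, Polynomial.count_roots,
      ← Matrix.charpoly_toLin' G, ← LinearMap.finrank_maxGenEigenspace_eq]
    refine Nat.pos_of_ne_zero fun h0 => ?_
    exact (hfin.mem_toFinset.1 hc) (Submodule.finrank_eq_zero.1 h0)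
  · intro c hc
    have hbot : f.maxGenEigenspace c = ⊥ := by
      by_contra h
      exact (Finset.mem_sdiff.1 hc).2 (hfin.mem_toFinset.2 h)
    rw [Polynomial.count_roots, ← Matrix.charpoly_toLin' G, ← LinearMap.finrank_maxGenEigenspace_eq,
      ← hf, hbot, finrank_bot, Nat.cast_zero, zero_mul]

lemma exists_add_self_eq_of_even_count {α : Type*} [DecidableEq α] (s : Multiset α)
    (h : ∀ c, Even (s.count c)) : ∃ t : Multiset α, s = t + t := by
  refine ⟨∑ c ∈ s.toFinset, Multiset.replicate (s.count c / 2) c, ?_⟩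
  ext c
  have hc : Multiset.count c (∑ c ∈ s.toFinset, Multiset.replicate (s.count c / 2) c) =
      s.count c / 2 := by
    rw [Multiset.count_sum']
    simp only [Multiset.count_replicate]
    rw [Finset.sum_ite_eq' s.toFinset c]
    split_ifs with hmem
    · rfl
    · rw [Multiset.mem_toFinset, ← Multiset.count_eq_zero] at hmem
      rw [hmem, Nat.zero_div]
  rw [Multiset.count_add, hc]
  obtain ⟨k, hk⟩ := h c
  omega

/-- The spectrum of a product of two antisymmetric matrices, one of them invertible, is doubly
degenerate. -/
theorem exists_half_spectrum {N : ℕ} (γ ω : Matrix (Fin N) (Fin N) ℂ)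
    (hγ : γᵀ = -γ) (hω : ωᵀ = -ω) (hdet : γ.det ≠ 0) :
    ∃ r, N = 2 * r ∧ ∃ lam : Fin r → ℂ,
      (∀ c, (γ * ω).charpoly.rootMultiplicity c = 2 * Nat.card {k // lam k = c}) ∧
      ∀ l, ((γ * ω) ^ l).trace = 2 * ∑ k, lam k ^ l := by
  classical
  obtain ⟨t, ht⟩ := exists_add_self_eq_of_even_count (γ * ω).charpoly.roots fun c => by
    rw [Polynomial.count_roots]
    exact even_rootMultiplicity_charpoly γ ω hγ hω hdet c
  have hcard : N = 2 * t.toList.length := by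
    have h := (IsAlgClosed.splits (γ * ω).charpoly).natDegree_eq_card_roots
    rw [Matrix.charpoly_natDegree_eq_dim, Fintype.card_fin, ht, Multiset.card_add] at h
    rw [Multiset.length_toList]
    omega
  have hmap : Finset.univ.val.map t.toList.get = t := by
    rw [Fin.univ_val_map, List.ofFn_get, Multiset.coe_toList]
  refine ⟨t.toList.length, hcard, t.toList.get, fun c => ?_, fun l => ?_⟩
  · rw [← Polynomial.count_roots, ht, Multiset.count_add, ← two_mul]
    congr 1
    conv_lhs => rw [← hmap]
    rw [Multiset.count_map, Nat.card_eq_fintype_card, Fintype.card_subtype]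
    simp only [eq_comm (a := c)]
    rfl
  · rw [trace_pow_eq_sum_roots, ht, Multiset.map_add, Multiset.sum_add, ← two_mul]
    congr 1
    conv_lhs => rw [← hmap]
    rw [Multiset.map_map]
    rfl

end SkewMatrices

/-! ### Minimal factorizations of a self-dual kernel -/

section MinimalFactorization

variable {Λ : Type*} [MeasurableSpace Λ] {μ : Measure Λ} {K : Λ → Λ → QC}

/-- Linear independence over `ℂ` of the classes of functions modulo null sets. -/
def AEIndep (μ : Measure Λ) {N : ℕ} (a : Fin N → Λ → QC) : Prop :=
  ∀ c : Fin N → ℂ, (∀ᵐ x ∂μ, ∑ i, c i • a i x = 0) → c = 0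

lemma exists_isFactorization (hK : IsFiniteRankKernel μ K) :
    ∃ (N : ℕ) (a b : Fin N → Λ → QC), IsFactorization μ K a b := by
  obtain ⟨n, f, g, hf, hg, hgf, hfg⟩ := hK
  -- The resolution of the identity `1 = proj * proj - (j * proj) * (proj * j)` is inserted between
  -- `fₖ` and `gₖ`, which doubles the number of terms.
  let e : Fin (n * 2) ≃ Fin n × Fin 2 := finProdFinEquiv.symm
  let u : Fin 2 → QC := ![proj, -(unitJ * proj)]
  let w : Fin 2 → QC := ![proj, proj * unitJ]
  have hu : ∀ s, u s * proj = u s := by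
    intro s
    fin_cases s
    · exact proj_mul_proj
    · simp [u, mul_assoc, proj_mul_proj]
  have hw : ∀ s, proj * w s = w s := by
    intro s
    fin_cases s
    · exact proj_mul_proj
    · simp [w, ← mul_assoc, proj_mul_proj]
  refine ⟨n * 2, fun i x => f (e i).1 x * u (e i).2, fun i x => w (e i).2 * g (e i).1 x,
    fun i => aestronglyMeasurable_mul_const (hf _) _,
    fun i => aestronglyMeasurable_const_mul (hg _) _, fun i x => ?_, fun i x => ?_,
    fun i j => ?_, Set.univ, univ_mem, fun x _ y _ => ?_⟩
  · rw [mul_assoc, hu]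
  · rw [← mul_assoc, hw]
  · refine (integrable_mul_const (integrable_const_mul (hgf (e i).1 (e j).1) (w (e i).2))
      (u (e j).2)).congr (Eventually.of_forall fun x => ?_)
    simp only [mul_assoc]
  · rw [hfg, e.sum_comp fun p => f p.1 x * u p.2 * (w p.2 * g p.1 y), Fintype.sum_prod_type]
    refine Finset.sum_congr rfl fun k _ => ?_
    have h2 : u 0 * w 0 + u 1 * w 1 = 1 := by
      have : unitJ * proj * (proj * unitJ) = unitJ * proj * unitJ := by
        rw [mul_assoc, ← mul_assoc proj, proj_mul_proj, mul_assoc]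
      simp [u, w, proj_mul_proj, this, ← sub_eq_add_neg, proj_sub_unitJ_mul_proj_mul_unitJ]
    rw [Fin.sum_univ_two]
    calc f k x * g k y = f k x * (u 0 * w 0 + u 1 * w 1) * g k y := by rw [h2, mul_one]
      _ = _ := by noncomm_ring

/-- A linear relation expresses one `aₖ` through the others, and its term is absorbed into their
right factors. The null set where the relation fails is removed from `S`. -/
lemma IsFactorization.reduce {N : ℕ} {a b : Fin (N + 1) → Λ → QC} (h : IsFactorization μ K a b)
    (hdep : ¬ AEIndep μ a) : ∃ a' b' : Fin N → Λ → QC, IsFactorization μ K a' b' := by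
  simp only [AEIndep, not_forall] at hdep
  obtain ⟨c, hc, hc0⟩ := hdep
  obtain ⟨k, hk⟩ := Function.ne_iff.1 hc0
  obtain ⟨S, hS, hK⟩ := h.exists_eq
  refine ⟨fun i => a (k.succAbove i),
    fun i x => b (k.succAbove i) x - (c (k.succAbove i) / c k) • b k x,
    fun i => h.aesm_left _, fun i => (h.aesm_right (k.succAbove i)).sub
      ((h.aesm_right k).const_smul (c (k.succAbove i) / c k)),
    fun i => h.left_mul_proj _, fun i x => ?_, fun i j => ?_,
    S ∩ {x | ∑ i, c i • a i x = 0}, inter_mem hS hc, fun x hx y hy => ?_⟩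
  · rw [mul_sub, mul_smul_comm, h.proj_mul_right, h.proj_mul_right]
  · refine ((h.integrable_mul (k.succAbove i) (k.succAbove j)).sub
      ((h.integrable_mul k (k.succAbove j)).smul (c (k.succAbove i) / c k))).congr
      (Eventually.of_forall fun x => ?_)
    simp only [Pi.sub_apply, Pi.smul_apply, sub_mul, smul_mul_assoc]
  · rw [hK x hx.1 y hy.1, Fin.sum_univ_succAbove _ k]
    have hak : a k x = -∑ i, (c (k.succAbove i) / c k) • a (k.succAbove i) x := by
      have h0 : ∑ i, c i • a i x = 0 := hx.2
      rw [Fin.sum_univ_succAbove _ k] at h0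
      have h1 := congrArg (fun q => (c k)⁻¹ • q) h0
      simp only [smul_add, smul_zero, inv_smul_smul₀ hk, Finset.smul_sum, smul_smul] at h1
      rw [eq_neg_iff_add_eq_zero, ← h1]
      simp only [div_eq_inv_mul]
    rw [hak, neg_mul, Finset.sum_mul, neg_add_eq_sub, ← Finset.sum_sub_distrib]
    refine Finset.sum_congr rfl fun i _ => ?_
    rw [mul_sub, smul_mul_assoc, mul_smul_comm]

/-- The function `j a*`, with values in `proj * QC` if `a` has values in `QC * proj`. -/
def dualLeft {N : ℕ} (a : Fin N → Λ → QC) : Fin N → Λ → QC := fun i x => unitJ * star (a i x)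

/-- The function `-b* j`, with values in `QC * proj` if `b` has values in `proj * QC`. -/
def dualRight {N : ℕ} (b : Fin N → Λ → QC) : Fin N → Λ → QC := fun i x => -(star (b i x) * unitJ)

lemma proj_mul_unitJ : proj * unitJ = unitJ * star proj := by
  ext <;> simp

lemma proj_mul_unitJ_mul_star {q : QC} (h : q * proj = q) :
    proj * (unitJ * star q) = unitJ * star q := by
  rw [← mul_assoc, proj_mul_unitJ, mul_assoc, ← star_mul, h]

lemma star_mul_unitJ_mul_proj {q : QC} (h : proj * q = q) :
    star q * unitJ * proj = star q * unitJ := by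
  rw [mul_assoc, ← star_proj_mul_unitJ, ← mul_assoc, ← star_mul, h]

/-- Apply `star` to the factorization of `K (y, x)` and insert `1 = -j * j`: the `j` moves the
factors back into the ideals `QC * proj` and `proj * QC`. -/
lemma IsFactorization.dual (hself : ∀ x y, K y x = star (K x y)) {N : ℕ}
    {a b : Fin N → Λ → QC} (h : IsFactorization μ K a b) :
    IsFactorization μ K (dualRight b) (dualLeft a) := by
  obtain ⟨S, hS, hK⟩ := h.exists_eq
  refine ⟨fun i => (aestronglyMeasurable_mul_const (aestronglyMeasurable_star (h.aesm_right i))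
      unitJ).neg,
    fun i => aestronglyMeasurable_const_mul (aestronglyMeasurable_star (h.aesm_left i)) unitJ,
    fun i x => ?_, fun i x => proj_mul_unitJ_mul_star (h.left_mul_proj i x), fun i j => ?_,
    S, hS, fun x hx y hy => ?_⟩
  · rw [dualRight, neg_mul, star_mul_unitJ_mul_proj (h.proj_mul_right i x)]
  · refine (integrable_mul_const (integrable_const_mul (integrable_star (h.integrable_mul j i))
      unitJ) (-unitJ)).congr (Eventually.of_forall fun x => ?_)
    simp only [dualLeft, dualRight, star_mul]
    noncomm_ring
  · rw [hself y x, hK y hy x hx, star_sum]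
    refine Finset.sum_congr rfl fun i _ => ?_
    rw [star_mul, dualLeft, dualRight, neg_mul, mul_assoc, ← mul_assoc unitJ, unitJ_mul_unitJ]
    noncomm_ring

lemma star_smul_eq (c : ℂ) (q : QC) : star (c • q) = c • star q :=
  starL.map_smul c q

lemma sum_smul_dualLeft {Λ : Type*} {N : ℕ} (a : Fin N → Λ → QC) (c : Fin N → ℂ) (x : Λ) :
    ∑ i, c i • dualLeft a i x = unitJ * star (∑ i, c i • a i x) := by
  rw [star_sum, Finset.mul_sum]
  refine Finset.sum_congr rfl fun i _ => ?_
  rw [star_smul_eq, mul_smul_comm, dualLeft]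

lemma sum_smul_dualRight {Λ : Type*} {N : ℕ} (b : Fin N → Λ → QC) (c : Fin N → ℂ) (x : Λ) :
    ∑ i, c i • dualRight b i x = -(star (∑ i, c i • b i x) * unitJ) := by
  rw [star_sum, Finset.sum_mul, ← Finset.sum_neg_distrib]
  refine Finset.sum_congr rfl fun i _ => ?_
  rw [star_smul_eq, smul_mul_assoc, dualRight, smul_neg]

lemma AEIndep.dualLeft {N : ℕ} {a : Fin N → Λ → QC} (h : AEIndep μ a) :
    AEIndep μ (dualLeft a) := by
  refine fun c hc => h c ?_
  filter_upwards [hc] with x hx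
  rw [sum_smul_dualLeft] at hx
  have := congrArg (fun q => unitJ * q) hx
  simp only [← mul_assoc, unitJ_mul_unitJ, neg_mul, one_mul, mul_zero, neg_eq_zero] at this
  exact star_eq_zero.1 this

lemma AEIndep.of_dualRight {N : ℕ} {b : Fin N → Λ → QC} (h : AEIndep μ (dualRight b)) :
    AEIndep μ b := by
  refine fun c hc => h c ?_
  filter_upwards [hc] with x hx
  rw [sum_smul_dualRight, hx]
  simp

/-- A factorization of a self-dual kernel with both systems of functions linearly independent. -/
lemma exists_isFactorization_aeIndep (hself : ∀ x y, K y x = star (K x y))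
    (hK : IsFiniteRankKernel μ K) : ∃ (N : ℕ) (a b : Fin N → Λ → QC),
      IsFactorization μ K a b ∧ AEIndep μ a ∧ AEIndep μ b := by
  classical
  have hex := exists_isFactorization hK
  -- In a factorization of least length the left factors are independent. The dual factorization has
  -- the same length, so this also yields independence of the right factors.
  have hmin : ∀ a b : Fin (Nat.find hex) → Λ → QC, IsFactorization μ K a b → AEIndep μ a := by
    have hlt := fun m => Nat.find_min hex (m := m)
    generalize Nat.find hex = N at hlt
    intro a b h
    by_contra hdep
    cases N with
    | zero => exact hdep fun c _ => Subsingleton.elim _ _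
    | succ N => exact hlt N N.lt_succ_self (h.reduce hdep)
  obtain ⟨a, b, h⟩ := Nat.find_spec hex
  exact ⟨_, a, b, h, hmin a b h, (hmin _ _ (h.dual hself)).of_dualRight⟩

/-- The scalar parts of `p * aᵢ(x)` span the whole space if the `aᵢ` are independent. -/
lemma AEIndep.eq_top {N : ℕ} {a : Fin N → Λ → QC} (h : AEIndep μ a)
    (L : Submodule ℂ (Fin N → ℂ)) (hL : ∀ᵐ x ∂μ, ∀ p : QC, (fun i => (p * a i x).re) ∈ L) :
    L = ⊤ := by
  by_contra hne
  -- The coefficients of a functional that vanishes on `L` are a linear relation between the `aᵢ`.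
  obtain ⟨φ, hφ0, hφ⟩ := Submodule.exists_le_ker_of_lt_top L (lt_top_iff_ne_top.2 hne)
  refine hφ0 ?_
  have hφv : ∀ v, φ v = ∑ i, v i * φ (Pi.single i 1) := by
    intro v
    rw [LinearMap.pi_apply_eq_sum_univ φ v]
    refine Finset.sum_congr rfl fun i _ => ?_
    rw [smul_eq_mul]
    congr 2
    funext j
    simp [Pi.single_apply, eq_comm]
  have hc : (fun i => φ (Pi.single i 1)) = 0 := by
    refine h _ ?_
    filter_upwards [hL] with x hx
    refine eq_zero_of_re_mul_eq_zero fun p => ?_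
    have h0 := LinearMap.mem_ker.1 (hφ (hx p))
    rw [hφv] at h0
    rw [re_mul_comm, Finset.mul_sum, re_sum]
    refine Eq.trans ?_ h0
    refine Finset.sum_congr rfl fun i _ => ?_
    rw [mul_smul_comm, re_smul, mul_comm]
  refine LinearMap.ext fun v => ?_
  rw [hφv, LinearMap.zero_apply]
  exact Finset.sum_eq_zero fun i _ => by rw [congrFun hc i, Pi.zero_apply, mul_zero]

/-- With `x` fixed, multiplying `K (x, y)` by `proj * p` on the left yields complex combinations of
the `bᵢ(y)`. With `AEIndep.eq_top` this recovers each `bᵢ` from the kernel. -/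
lemma sum_re_mul_smul {N : ℕ} {a b : Fin N → QC} (ha : ∀ i, a i * proj = a i)
    (hb : ∀ i, proj * b i = b i) (p : QC) :
    ∑ i, (p * a i).re • b i = (1 / 2 : ℂ) • (proj * p * ∑ i, a i * b i) := by
  rw [Finset.mul_sum, Finset.smul_sum]
  refine Finset.sum_congr rfl fun i _ => ?_
  have h := proj_mul_mul_proj (p * a i)
  rw [mul_assoc, mul_assoc, ha] at h
  rw [← mul_assoc, mul_assoc proj, h, smul_mul_assoc, hb, smul_smul]
  congr 1
  ring

/-- In a minimal factorization of a self-dual kernel, the right factors are the duals of the left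
ones, up to an invertible antisymmetric matrix. -/
lemma IsFactorization.exists_skew {N : ℕ} {a b : Fin N → Λ → QC}
    (hself : ∀ x y, K y x = star (K x y)) (h : IsFactorization μ K a b) (ha : AEIndep μ a)
    (hb : AEIndep μ b) : ∃ γ : Matrix (Fin N) (Fin N) ℂ, γ.transpose = -γ ∧ γ.det ≠ 0 ∧
      ∀ᵐ y ∂μ, ∀ i, b i y = ∑ j, γ i j • dualLeft a j y := by
  obtain ⟨S, hS, hK⟩ := h.exists_eq
  have hd := h.dual hself
  have hK' : ∀ x ∈ S, ∀ y ∈ S, ∑ i, a i x * b i y =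
      ∑ i, dualRight b i x * dualLeft a i y := by
    intro x hx y hy
    rw [← hK x hx y hy, hself y x, hK y hy x hx, star_sum]
    refine Finset.sum_congr rfl fun i _ => ?_
    rw [star_mul, PfaffianField.dualLeft, PfaffianField.dualRight, neg_mul, mul_assoc,
      ← mul_assoc unitJ, unitJ_mul_unitJ]
    noncomm_ring
  -- Coefficients `c` for which `∑ cᵢ bᵢ` is a combination of the dual functions. Comparing both
  -- factorizations at each `x ∈ S` shows that `L` is everything; its unit vectors give the rows of
  -- `γ`.
  let L : Submodule ℂ (Fin N → ℂ) :=
    { carrier := {c | ∃ d : Fin N → ℂ, ∀ y ∈ S, ∑ i, c i • b i y = ∑ j, d j • dualLeft a j y}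
      add_mem' := by
        rintro c c' ⟨d, hd⟩ ⟨d', hd'⟩
        refine ⟨d + d', fun y hy => ?_⟩
        simp only [Pi.add_apply, add_smul, Finset.sum_add_distrib, hd y hy, hd' y hy]
      zero_mem' := ⟨0, fun y _ => by simp⟩
      smul_mem' := by
        rintro z c ⟨d, hd⟩
        refine ⟨z • d, fun y hy => ?_⟩
        simp only [Pi.smul_apply, smul_assoc, ← Finset.smul_sum, hd y hy] }
  have hL : L = ⊤ := by
    refine ha.eq_top L ?_
    filter_upwards [hS] with x hx
    refine fun p => ⟨fun j => (p * dualRight b j x).re, fun y hy => ?_⟩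
    rw [sum_re_mul_smul (fun i => h.left_mul_proj i x) (fun i => h.proj_mul_right i y),
      sum_re_mul_smul (fun i => hd.left_mul_proj i x) (fun i => hd.proj_mul_right i y),
      hK' x hx y hy]
  have hrow : ∀ k, ∃ d : Fin N → ℂ, ∀ y ∈ S, b k y = ∑ j, d j • dualLeft a j y := by
    intro k
    have hk : Pi.single k 1 ∈ L := hL ▸ Submodule.mem_top
    obtain ⟨d, hd⟩ := hk
    refine ⟨d, fun y hy => ?_⟩
    rw [← hd y hy, Finset.sum_eq_single k]
    · simp
    · intro i _ hik; simp [hik]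
    · simp
  choose γ hγ using hrow
  -- Self-duality replaces `γ` by `-γᵀ` in the expansion of `K`, so the symmetric part of `γ`
  -- contributes nothing; independence of the `aᵢ` and of their duals then kills it.
  have hsum : ∀ x ∈ S, ∀ y ∈ S, ∑ i, a i x * ∑ j, (γ i j + γ j i) • dualLeft a j y = 0 := by
    intro x hx y hy
    have h1 : ∑ i, a i x * ∑ j, γ i j • dualLeft a j y = K x y := by
      rw [hK x hx y hy]
      exact Finset.sum_congr rfl fun i _ => by rw [hγ i y hy]
    have h2 : ∑ i, a i x * ∑ j, γ j i • dualLeft a j y = -K x y := by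
      rw [hself y x, hK y hy x hx, star_sum, ← Finset.sum_neg_distrib]
      simp only [Finset.mul_sum]
      rw [Finset.sum_comm]
      refine Finset.sum_congr rfl fun j _ => ?_
      rw [hγ j x hx, star_mul, star_sum, Finset.sum_mul, ← Finset.sum_neg_distrib]
      refine Finset.sum_congr rfl fun i _ => ?_
      rw [star_smul_eq, PfaffianField.dualLeft, PfaffianField.dualLeft, star_mul, star_star,
        star_unitJ, mul_smul_comm, smul_mul_assoc, mul_neg, neg_mul, smul_neg, neg_neg, mul_assoc]
    simp only [add_smul, Finset.sum_add_distrib, mul_add, h1, h2, add_neg_cancel]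
  refine ⟨Matrix.of γ, ?_, ?_, ?_⟩
  · let M : Submodule ℂ (Fin N → ℂ) :=
      { carrier := {c | ∀ y ∈ S, ∑ i, c i • ∑ j, (γ i j + γ j i) • dualLeft a j y = 0}
        add_mem' := by
          intro c c' hc hc' y hy
          simp only [Pi.add_apply, add_smul (_ : ℂ), Finset.sum_add_distrib]
          have e1 := hc y hy
          have e2 := hc' y hy
          simp only [add_smul, Finset.sum_add_distrib] at e1 e2
          rw [e1, e2, add_zero]
        zero_mem' := fun y _ => by simp
        smul_mem' := by
          intro z c hc y hy
          simp only [Pi.smul_apply, smul_assoc, ← Finset.smul_sum]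
          rw [hc y hy, smul_zero] }
    have hM : M = ⊤ := by
      refine ha.eq_top M ?_
      filter_upwards [hS] with x hx
      intro p y hy
      rw [sum_re_mul_smul (fun i => h.left_mul_proj i x) (fun i => ?_), hsum x hx y hy, mul_zero,
        smul_zero]
      rw [Finset.mul_sum]
      exact Finset.sum_congr rfl fun j _ => by rw [mul_smul_comm, hd.proj_mul_right]
    ext i j
    have hz : (fun j => γ i j + γ j i) = 0 := by
      refine ha.dualLeft _ ?_
      filter_upwards [hS] with y hy
      have hi : Pi.single i 1 ∈ M := hM ▸ Submodule.mem_top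
      have e := hi y hy
      rw [Finset.sum_eq_single i (fun k _ hik => by simp [hik]) (by simp)] at e
      simpa using e
    have := congrFun hz j
    rw [Matrix.transpose_apply, Matrix.neg_apply, Matrix.of_apply, Matrix.of_apply]
    exact (neg_eq_of_add_eq_zero_right this).symm
  · intro hdet
    obtain ⟨v, hv, hvγ⟩ := Matrix.exists_vecMul_eq_zero_iff.2 hdet
    refine hv (hb v ?_)
    filter_upwards [hS] with y hy
    simp only [fun i => hγ i y hy, Finset.smul_sum, smul_smul]
    rw [Finset.sum_comm]
    refine Finset.sum_eq_zero fun j _ => ?_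
    rw [← Finset.sum_smul]
    have := congrFun hvγ j
    simp only [Matrix.vecMul, dotProduct, Matrix.of_apply, Pi.zero_apply] at this
    rw [this, zero_smul]
  · filter_upwards [hS] with y hy
    exact fun i => hγ i y hy

/-- The Gram matrix of a minimal factorization of a self-dual kernel is a product of two
antisymmetric matrices. -/
lemma IsFactorization.exists_gram_eq_mul {N : ℕ} {a b : Fin N → Λ → QC}
    (hself : ∀ x y, K y x = star (K x y)) (h : IsFactorization μ K a b) (ha : AEIndep μ a)
    (hb : AEIndep μ b) : ∃ γ ω : Matrix (Fin N) (Fin N) ℂ, γ.transpose = -γ ∧ ω.transpose = -ω ∧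
      γ.det ≠ 0 ∧ gram μ a b = γ * ω := by
  obtain ⟨γ, hγ, hdet, hba⟩ := h.exists_skew hself ha hb
  have hunit : IsUnit γ.det := isUnit_iff_ne_zero.2 hdet
  -- Removing `γ` turns `bᵢ` into `j aᵢ*`. The form `re (j aᵢ* aⱼ)` is antisymmetric because `star j
  -- = -j`.
  have hω : ∀ i j, (γ⁻¹ * gram μ a b) i j = ∫ x, 2 * (dualLeft a i x * a j x).re ∂μ := by
    intro i j
    simp only [Matrix.mul_apply, gram, Matrix.of_apply]
    simp only [← integral_const_mul (μ := μ)]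
    rw [← integral_finsetSum _ fun k _ => (integrable_pairing h k j).const_mul _]
    refine integral_congr_ae ?_
    filter_upwards [hba] with x hx
    have hdl : dualLeft a i x = ∑ k, γ⁻¹ i k • b k x := by
      simp only [hx, Finset.smul_sum, smul_smul]
      rw [Finset.sum_comm]
      simp only [← Finset.sum_smul]
      have : ∀ l, ∑ k, γ⁻¹ i k * γ k l = (1 : Matrix (Fin N) (Fin N) ℂ) i l := by
        intro l
        rw [← Matrix.nonsing_inv_mul γ hunit, Matrix.mul_apply]
      simp [this, Matrix.one_apply]
    rw [hdl, Finset.sum_mul, re_sum, Finset.mul_sum]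
    refine Finset.sum_congr rfl fun k _ => ?_
    rw [pairing, Matrix.of_apply, smul_mul_assoc, re_smul]
    ring
  refine ⟨γ, γ⁻¹ * gram μ a b, hγ, ?_, hdet, ?_⟩
  · ext i j
    rw [Matrix.transpose_apply, Matrix.neg_apply, hω, hω, ← integral_neg]
    congr 1
    funext x
    have hskew : (dualLeft a j x * a i x).re = -(dualLeft a i x * a j x).re := by
      rw [← re_star, star_mul, PfaffianField.dualLeft, star_mul, star_star,
        star_unitJ, ← mul_assoc, re_mul_comm, neg_mul, PfaffianField.dualLeft, mul_assoc]
      exact QuaternionAlgebra.re_neg _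
    rw [hskew]
    ring
  · rw [Matrix.mul_nonsing_inv_cancel_left _ _ hunit]

end MinimalFactorization

/-! ### The integral operator with a finite-rank kernel -/

section GeneralizedEigenspaces

open Module

variable {C D : Type*} [AddCommGroup C] [Module ℂ C] [AddCommGroup D] [Module ℂ D]

lemma sub_pow_comp_apply (F : C →ₗ[ℂ] D) (H : D →ₗ[ℂ] C) (c : ℂ) (k : ℕ) (w : C) :
    ((F ∘ₗ H - c • (1 : End ℂ D)) ^ k) (F w) = F (((H ∘ₗ F - c • (1 : End ℂ C)) ^ k) w) := by
  induction k generalizing w with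
  | zero => rfl
  | succ k ih =>
    rw [pow_succ, pow_succ, Module.End.mul_apply, Module.End.mul_apply, ← ih]
    congr 1
    simp

/-- From `c v = F (H v) - (F H - c) v`, by induction on the power, a generalized eigenvector for `c
≠ 0` lies in the range of `F`. -/
lemma mem_range_of_sub_pow_apply_eq_zero (F : C →ₗ[ℂ] D) (H : D →ₗ[ℂ] C) {c : ℂ} (hc : c ≠ 0)
    (k : ℕ) (v : D) (hv : ((F ∘ₗ H - c • (1 : End ℂ D)) ^ k) v = 0) : v ∈ LinearMap.range F := by
  induction k generalizing v with
  | zero =>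
    have : v = 0 := hv
    exact this ▸ zero_mem _
  | succ k ih =>
    rw [pow_succ, Module.End.mul_apply] at hv
    have h1 : F (H v) - c • v ∈ LinearMap.range F := ih _ hv
    have h2 : c • v ∈ LinearMap.range F := by
      have := Submodule.sub_mem _ (LinearMap.mem_range_self F (H v)) h1
      rwa [sub_sub_cancel] at this
    exact (Submodule.smul_mem_iff _ hc).1 h2

/-- The generalized eigenspaces of `F H` and `H F` for nonzero eigenvalues. -/
lemma finrank_maxGenEigenspace_comp (F : C →ₗ[ℂ] D) (H : D →ₗ[ℂ] C) (hF : Function.Injective F)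
    {c : ℂ} (hc : c ≠ 0) :
    finrank ℂ (End.maxGenEigenspace (F ∘ₗ H) c) = finrank ℂ (End.maxGenEigenspace (H ∘ₗ F) c) := by
  have h : End.maxGenEigenspace (F ∘ₗ H) c = (End.maxGenEigenspace (H ∘ₗ F) c).map F := by
    ext v
    rw [Submodule.mem_map]
    constructor
    · intro hv
      obtain ⟨k, hk⟩ := (End.mem_maxGenEigenspace _ _ _).1 hv
      obtain ⟨w, rfl⟩ := mem_range_of_sub_pow_apply_eq_zero F H hc k v hk
      rw [sub_pow_comp_apply] at hk
      exact ⟨w, (End.mem_maxGenEigenspace _ _ _).2 ⟨k, hF (hk.trans (map_zero F).symm)⟩, rfl⟩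
    · rintro ⟨w, hw, rfl⟩
      obtain ⟨k, hk⟩ := (End.mem_maxGenEigenspace _ _ _).1 hw
      exact (End.mem_maxGenEigenspace _ _ _).2 ⟨k, by rw [sub_pow_comp_apply, hk, map_zero]⟩
  rw [h]
  exact (LinearEquiv.finrank_eq (Submodule.equivMapOfInjective F hF _)).symm

lemma finrank_maxGenEigenspace_prodMap {N : ℕ} (G : Matrix (Fin N) (Fin N) ℂ) (c : ℂ) :
    finrank ℂ (End.maxGenEigenspace ((Matrix.toLin' G).prodMap (Matrix.toLin' G)) c) =
      2 * G.charpoly.rootMultiplicity c := by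
  rw [LinearMap.finrank_maxGenEigenspace_eq, LinearMap.charpoly_prodMap, Matrix.charpoly_toLin',
    Polynomial.rootMultiplicity_mul, two_mul]
  exact mul_ne_zero G.charpoly_monic.ne_zero G.charpoly_monic.ne_zero

end GeneralizedEigenspaces

/-! ### Factoring the integral operator through pairs of complex coordinate vectors -/

section Operator

variable {Λ : Type*} [MeasurableSpace Λ] {μ : Measure Λ} {K : Λ → Λ → QC} {N : ℕ}
  {a b : Fin N → Λ → QC}

lemma IsFactorization.integrable_kernel_mul (h : IsFactorization μ K a b) {v : Λ → QC}
    (hv : ∀ i, Integrable (fun y => b i y * v y) μ) :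
    ∀ᵐ x ∂μ, Integrable (fun y => K x y * v y) μ ∧
      ∫ y, K x y * v y ∂μ = ∑ i, a i x * ∫ y, b i y * v y ∂μ := by
  obtain ⟨S, hS, hK⟩ := h.exists_eq
  filter_upwards [hS] with x hx
  have hae : (fun y => ∑ i, a i x * (b i y * v y)) =ᵐ[μ] fun y => K x y * v y := by
    filter_upwards [hS] with y hy
    rw [hK x hx y hy, Finset.sum_mul]
    exact Finset.sum_congr rfl fun i _ => (mul_assoc _ _ _).symm
  refine ⟨(integrable_finsetSum _ fun i _ => integrable_const_mul (hv i) _).congr hae, ?_⟩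
  rw [← integral_congr_ae hae, integral_finsetSum _ fun i _ => integrable_const_mul (hv i) _]
  exact Finset.sum_congr rfl fun i _ => integral_const_mul' (hv i) _

/-- By independence of the `aᵢ`, each `bᵢ` is a combination of left multiples of the functions `K
(x, ·)`, so integrability of `K (x, ·) v` passes to `bᵢ v`. -/
lemma IsFactorization.mem_kernelDomain_iff (h : IsFactorization μ K a b) (ha : AEIndep μ a)
    (v : Λ →ₘ[μ] QC) :
    v ∈ kernelDomain μ K ↔ ∀ i, Integrable (fun y => b i y * v y) μ := by
  constructor
  · intro hv
    obtain ⟨S, hS, hK⟩ := h.exists_eq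
    let L : Submodule ℂ (Fin N → ℂ) :=
      { carrier := {c | Integrable (fun y => (∑ i, c i • b i y) * v y) μ}
        add_mem' := fun {c c'} hc hc' => (Integrable.add hc hc').congr
          (Eventually.of_forall fun y => by
            simp only [Pi.add_apply, add_smul, Finset.sum_add_distrib, add_mul])
        zero_mem' := (integrable_zero Λ QC μ).congr (Eventually.of_forall fun y => by simp)
        smul_mem' := fun z c hc => (Integrable.smul z hc).congr
          (Eventually.of_forall fun y => by
            simp only [Pi.smul_apply, smul_assoc, ← Finset.smul_sum, smul_mul_assoc]) }
    have hL : L = ⊤ := by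
      refine ha.eq_top L ?_
      have hv' : ∀ᵐ x ∂μ, Integrable (fun y => K x y * v y) μ := hv
      filter_upwards [hS, hv'] with x hx hvx
      intro p
      refine ((integrable_const_mul hvx (proj * p)).smul (1 / 2 : ℂ)).congr ?_
      filter_upwards [hS] with y hy
      rw [sum_re_mul_smul (fun i => h.left_mul_proj i x) (fun i => h.proj_mul_right i y),
        ← hK x hx y hy, Pi.smul_apply, smul_mul_assoc, mul_assoc (proj * p)]
    intro i
    have hi : Pi.single i 1 ∈ L := hL ▸ Submodule.mem_top
    refine Integrable.congr hi (Eventually.of_forall fun y => ?_)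
    simp only
    rw [Finset.sum_eq_single i (fun k _ hik => by simp [hik]) (by simp)]
    simp
  · intro hv
    exact (h.integrable_kernel_mul hv).mono fun x hx => hx.1

/-- The element of `proj * QC` with the given coordinates with respect to `proj`, `proj * j`. -/
def ofCoords (s t : ℂ) : QC := s • proj + t • (proj * unitJ)

lemma proj_mul_ofCoords (s t : ℂ) : proj * ofCoords s t = ofCoords s t := by
  rw [ofCoords, mul_add, mul_smul_comm, mul_smul_comm, ← mul_assoc, proj_mul_proj]

lemma ofCoords_re {p : QC} (hp : proj * p = p) :
    ofCoords (2 * p.re) (2 * (p * -unitJ).re) = p :=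
  (eq_smul_proj_add hp).symm

lemma two_mul_re_ofCoords (s t : ℂ) : 2 * (ofCoords s t).re = s := by
  simp [ofCoords]
  ring

lemma two_mul_re_ofCoords_mul (s t : ℂ) : 2 * (ofCoords s t * -unitJ).re = t := by
  simp [ofCoords]
  ring

lemma ofCoords_mul_proj (s t : ℂ) : ofCoords s t * proj = s • proj := by
  rw [ofCoords, add_mul, smul_mul_assoc, smul_mul_assoc, proj_mul_proj, proj_mul_unitJ_mul_proj,
    smul_zero, add_zero]

lemma ofCoords_mul_neg_unitJ_mul_proj (s t : ℂ) : ofCoords s t * -unitJ * proj = t • proj := by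
  have h : proj * unitJ * -unitJ = proj := by
    rw [mul_neg, mul_assoc, unitJ_mul_unitJ, mul_neg, mul_one, neg_neg]
  rw [ofCoords, add_mul, smul_mul_assoc, smul_mul_assoc, h, add_mul, smul_mul_assoc,
    smul_mul_assoc, proj_mul_proj, mul_neg, neg_mul, proj_mul_unitJ_mul_proj, neg_zero, smul_zero,
    zero_add]

/-- The function with the given coordinates in the range of the integral operator. -/
def combination (a : Fin N → Λ → QC) (c : (Fin N → ℂ) × (Fin N → ℂ)) (x : Λ) : QC :=
  ∑ i, a i x * ofCoords (c.1 i) (c.2 i)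

lemma IsFactorization.aesm_combination (h : IsFactorization μ K a b)
    (c : (Fin N → ℂ) × (Fin N → ℂ)) : AEStronglyMeasurable (combination a c) μ :=
  Finset.aestronglyMeasurable_fun_sum _ fun i _ => aestronglyMeasurable_mul_const (h.aesm_left i) _

/-- Because `bᵢ aⱼ` is a complex multiple of `proj`, both coordinate vectors are transformed by the
same matrix, independently of each other. -/
lemma IsFactorization.integrable_mul_combination (h : IsFactorization μ K a b)
    (c : (Fin N → ℂ) × (Fin N → ℂ)) (i : Fin N) :
    Integrable (fun y => b i y * combination a c y) μ ∧
    ∫ y, b i y * combination a c y ∂μ =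
      ofCoords ((gram μ a b).mulVec c.1 i) ((gram μ a b).mulVec c.2 i) := by
  have heq : (fun y => b i y * combination a c y) =
      fun y => ∑ j, pairing a b y i j • ofCoords (c.1 j) (c.2 j) := by
    funext y
    rw [combination, Finset.mul_sum]
    refine Finset.sum_congr rfl fun j _ => ?_
    rw [← mul_assoc, mul_eq_pairing_smul h.left_mul_proj h.proj_mul_right, smul_mul_assoc,
      proj_mul_ofCoords]
  have hint : ∀ j, Integrable (fun y => pairing a b y i j • ofCoords (c.1 j) (c.2 j)) μ :=
    fun j => (integrable_pairing h i j).smul_const _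
  rw [heq]
  refine ⟨integrable_finsetSum _ fun j _ => hint j, ?_⟩
  have hsmul : ∀ j, ∫ y, pairing a b y i j • ofCoords (c.1 j) (c.2 j) ∂μ =
      gram μ a b i j • ofCoords (c.1 j) (c.2 j) := fun j => integral_smul_const _ _
  rw [integral_finsetSum _ fun j _ => hint j, Finset.sum_congr rfl fun j _ => hsmul j]
  simp only [ofCoords, Matrix.mulVec, dotProduct, Finset.sum_smul, smul_add,
    smul_smul, Finset.sum_add_distrib]

/-- The parametrization of the range of the integral operator. -/
def synthesis (h : IsFactorization μ K a b) (ha : AEIndep μ a) :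
    (Fin N → ℂ) × (Fin N → ℂ) →ₗ[ℂ] kernelDomain μ K where
  toFun c := ⟨AEEqFun.mk (combination a c) (h.aesm_combination c), by
    rw [h.mem_kernelDomain_iff ha]
    intro i
    refine (h.integrable_mul_combination c i).1.congr ?_
    filter_upwards [AEEqFun.coeFn_mk (combination a c) (h.aesm_combination c)] with y hy
    rw [hy]⟩
  map_add' c c' := by
    refine Subtype.ext ?_
    rw [Submodule.coe_add, AEEqFun.mk_add_mk, AEEqFun.mk_eq_mk]
    refine Eventually.of_forall fun x => ?_
    simp only [combination, ofCoords, Prod.fst_add, Prod.snd_add, Pi.add_apply, add_smul, mul_add,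
      Finset.sum_add_distrib]
    abel
  map_smul' z c := by
    refine Subtype.ext ?_
    refine (AEEqFun.mk_eq_mk.2 (Eventually.of_forall fun x => ?_)).trans
      (AEEqFun.smul_mk z _ (h.aesm_combination c)).symm
    simp only [combination, ofCoords, Prod.smul_fst, Prod.smul_snd, Pi.smul_apply, smul_assoc,
      ← smul_add, mul_smul_comm, ← Finset.smul_sum]

lemma coeFn_synthesis (h : IsFactorization μ K a b) (ha : AEIndep μ a)
    (c : (Fin N → ℂ) × (Fin N → ℂ)) :
    ((synthesis h ha c : Λ →ₘ[μ] QC) : Λ → QC) =ᵐ[μ] combination a c :=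
  AEEqFun.coeFn_mk _ _

lemma integrable_analysis (h : IsFactorization μ K a b) (ha : AEIndep μ a)
    (v : kernelDomain μ K) (i : Fin N) : Integrable (fun y => b i y * (v : Λ →ₘ[μ] QC) y) μ :=
  (h.mem_kernelDomain_iff ha _).1 v.2 i

/-- The integrals `∫ bᵢ v` as a linear map. -/
def analysisAux (h : IsFactorization μ K a b) (ha : AEIndep μ a) :
    kernelDomain μ K →ₗ[ℂ] (Fin N → QC) where
  toFun v i := ∫ y, b i y * (v : Λ →ₘ[μ] QC) y ∂μ
  map_add' v w := by
    funext i
    rw [Pi.add_apply, ← integral_add (integrable_analysis h ha v i) (integrable_analysis h ha w i)]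
    refine integral_congr_ae ?_
    filter_upwards [AEEqFun.coeFn_add (v : Λ →ₘ[μ] QC) w] with y hy
    rw [Submodule.coe_add, hy, Pi.add_apply, mul_add]
  map_smul' z v := by
    funext i
    rw [Pi.smul_apply, RingHom.id_apply, ← integral_smul]
    refine integral_congr_ae ?_
    filter_upwards [AEEqFun.coeFn_smul z (v : Λ →ₘ[μ] QC)] with y hy
    rw [Submodule.coe_smul, hy, Pi.smul_apply, mul_smul_comm]

/-- The coordinates of the integrals `∫ bᵢ v`. -/
def analysis (h : IsFactorization μ K a b) (ha : AEIndep μ a) :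
    kernelDomain μ K →ₗ[ℂ] (Fin N → ℂ) × (Fin N → ℂ) :=
  LinearMap.prod
    (LinearMap.pi fun i => (2 : ℂ) • (reL.toLinearMap ∘ₗ LinearMap.proj i ∘ₗ analysisAux h ha))
    (LinearMap.pi fun i => (2 : ℂ) • ((reL ∘L mulRightL (-unitJ)).toLinearMap ∘ₗ
      LinearMap.proj i ∘ₗ analysisAux h ha))

lemma analysis_fst (h : IsFactorization μ K a b) (ha : AEIndep μ a) (v : kernelDomain μ K)
    (i : Fin N) : (analysis h ha v).1 i = 2 * (∫ y, b i y * (v : Λ →ₘ[μ] QC) y ∂μ).re := rfl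

lemma analysis_snd (h : IsFactorization μ K a b) (ha : AEIndep μ a) (v : kernelDomain μ K)
    (i : Fin N) : (analysis h ha v).2 i =
      2 * ((∫ y, b i y * (v : Λ →ₘ[μ] QC) y ∂μ) * -unitJ).re := rfl

lemma ofCoords_analysis (h : IsFactorization μ K a b) (ha : AEIndep μ a) (v : kernelDomain μ K)
    (i : Fin N) : ofCoords ((analysis h ha v).1 i) ((analysis h ha v).2 i) =
      ∫ y, b i y * (v : Λ →ₘ[μ] QC) y ∂μ := by
  rw [analysis_fst, analysis_snd, ofCoords_re]
  rw [← integral_const_mul' (integrable_analysis h ha v i)]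
  simp only [← mul_assoc, h.proj_mul_right]

lemma isIntegralOperator_synthesis_comp_analysis (h : IsFactorization μ K a b)
    (ha : AEIndep μ a) : IsIntegralOperator μ K (synthesis h ha ∘ₗ analysis h ha) := by
  intro v
  filter_upwards [coeFn_synthesis h ha (analysis h ha v),
    h.integrable_kernel_mul (integrable_analysis h ha v)] with x hx hx'
  rw [LinearMap.comp_apply, hx, hx'.2, combination]
  exact Finset.sum_congr rfl fun i _ => by rw [ofCoords_analysis]

lemma analysis_comp_synthesis (h : IsFactorization μ K a b) (ha : AEIndep μ a) :
    analysis h ha ∘ₗ synthesis h ha =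
      (Matrix.toLin' (gram μ a b)).prodMap (Matrix.toLin' (gram μ a b)) := by
  refine LinearMap.ext fun c => ?_
  have hI : ∀ i, ∫ y, b i y * (synthesis h ha c : Λ →ₘ[μ] QC) y ∂μ =
      ofCoords ((gram μ a b).mulVec c.1 i) ((gram μ a b).mulVec c.2 i) := by
    intro i
    rw [← (h.integrable_mul_combination c i).2]
    refine integral_congr_ae ?_
    filter_upwards [coeFn_synthesis h ha c] with y hy
    rw [hy]
  refine Prod.ext (funext fun i => ?_) (funext fun i => ?_)
  · rw [LinearMap.comp_apply, analysis_fst, hI, two_mul_re_ofCoords]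
    rfl
  · rw [LinearMap.comp_apply, analysis_snd, hI, two_mul_re_ofCoords_mul]
    rfl

/-- Right multiplication by `proj`, respectively `-j * proj`, isolates the first, respectively
second, coordinates and leaves a relation between the `aᵢ`. -/
lemma synthesis_injective (h : IsFactorization μ K a b) (ha : AEIndep μ a) :
    Function.Injective (synthesis h ha) := by
  rw [← LinearMap.ker_eq_bot, LinearMap.ker_eq_bot']
  intro c hc
  have h0 : ∀ᵐ x ∂μ, combination a c x = 0 := by
    have h1 := coeFn_synthesis h ha c
    rw [hc] at h1
    filter_upwards [h1, AEEqFun.coeFn_zero (α := Λ) (β := QC) (μ := μ)] with x hx hx0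
    rw [← hx]
    exact hx0
  refine Prod.ext (ha c.1 ?_) (ha c.2 ?_)
  · filter_upwards [h0] with x hx
    have h2 := congrArg (fun q => q * proj) hx
    simp only [combination, Finset.sum_mul, zero_mul, mul_assoc, ofCoords_mul_proj, mul_smul_comm,
      h.left_mul_proj] at h2
    exact h2
  · filter_upwards [h0] with x hx
    have h2 := congrArg (fun q => q * (-unitJ * proj)) hx
    simp only [combination, Finset.sum_mul, zero_mul] at h2
    rw [← h2]
    refine Finset.sum_congr rfl fun i _ => ?_
    rw [mul_assoc, ← mul_assoc (ofCoords _ _), ofCoords_mul_neg_unitJ_mul_proj, mul_smul_comm,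
      h.left_mul_proj]

/-- A positive weight whose products with finitely many given functions are integrable. -/
lemma exists_pos_weight [SigmaFinite μ] (hb : ∀ i, AEStronglyMeasurable (b i) μ) :
    ∃ ρ : Λ → ℝ, (∀ x, 0 < ρ x) ∧ AEStronglyMeasurable ρ μ ∧
      ∀ i, Integrable (fun x => (ρ x : ℂ) • b i x) μ := by
  obtain ⟨g, hg0, hgm, hg⟩ := exists_pos_lintegral_lt_of_sigmaFinite μ one_ne_zero
  have hgi : Integrable (fun x => (g x : ℝ)) μ := by
    refine ⟨hgm.coe_nnreal_real.aestronglyMeasurable, ?_⟩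
    rw [hasFiniteIntegral_iff_enorm]
    refine lt_of_le_of_lt (le_of_eq ?_) (hg.trans ENNReal.one_lt_top)
    refine lintegral_congr fun x => ?_
    simp
  have hpos : ∀ x, 0 < 1 + ∑ i, ‖b i x‖ := fun x =>
    add_pos_of_pos_of_nonneg one_pos (Finset.sum_nonneg fun i _ => norm_nonneg _)
  have hρm : AEStronglyMeasurable (fun x => (g x : ℝ) / (1 + ∑ i, ‖b i x‖)) μ := by
    refine AEMeasurable.aestronglyMeasurable (AEMeasurable.div hgi.aemeasurable ?_)
    exact (aestronglyMeasurable_const.add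
      (Finset.aestronglyMeasurable_fun_sum _ fun i _ => (hb i).norm)).aemeasurable
  refine ⟨fun x => g x / (1 + ∑ i, ‖b i x‖), fun x => div_pos (hg0 x) (hpos x), hρm, fun i => ?_⟩
  refine hgi.mono' ((Complex.continuous_ofReal.comp_aestronglyMeasurable hρm).smul (hb i))
    (Eventually.of_forall fun x => ?_)
  have hle : ‖b i x‖ ≤ 1 + ∑ i, ‖b i x‖ :=
    (Finset.single_le_sum (f := fun i => ‖b i x‖) (fun _ _ => norm_nonneg _)
      (Finset.mem_univ i)).trans (by linarith)
  change ‖((g x / (1 + ∑ i, ‖b i x‖) : ℝ) : ℂ) • b i x‖ ≤ g x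
  rw [norm_smul, Complex.norm_real, Real.norm_of_nonneg (div_pos (NNReal.coe_pos.2 (hg0 x)) (hpos x)).le,
    div_mul_eq_mul_div, div_le_iff₀ (hpos x)]
  exact mul_le_mul_of_nonneg_left hle (g x).2

/-- A functional that vanishes on the range gives a quaternion relation between the `bᵢ`, found by
testing on functions `ρ q` cut off to measurable sets. The weight `ρ` keeps them in the domain.
Independence of the `bᵢ` kills the functional. -/
lemma analysis_surjective [SigmaFinite μ] (h : IsFactorization μ K a b) (ha : AEIndep μ a)
    (hb : AEIndep μ b) : Function.Surjective (analysis h ha) := by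
  rw [← LinearMap.range_eq_top]
  by_contra hne
  obtain ⟨φ, hφ0, hφ⟩ := Submodule.exists_le_ker_of_lt_top _ (lt_top_iff_ne_top.2 hne)
  refine hφ0 ?_
  set c : Fin N → ℂ := fun i => φ (Pi.single i 1, 0) with hc
  set d : Fin N → ℂ := fun i => φ (0, Pi.single i 1) with hd
  have hφv : ∀ v, φ v = ∑ i, (v.1 i * c i + v.2 i * d i) := by
    intro v
    have h1 := LinearMap.pi_apply_eq_sum_univ (φ ∘ₗ LinearMap.inl ℂ _ (Fin N → ℂ)) v.1
    have h2 := LinearMap.pi_apply_eq_sum_univ (φ ∘ₗ LinearMap.inr ℂ (Fin N → ℂ) _) v.2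
    have h3 : φ v = φ (v.1, 0) + φ (0, v.2) := by rw [← map_add]; simp
    have h4 : ∀ i : Fin N, (fun j => if i = j then (1 : ℂ) else 0) = Pi.single i 1 := by
      intro i
      funext j
      simp [Pi.single_apply, eq_comm]
    rw [h3, Finset.sum_add_distrib]
    simp only [LinearMap.comp_apply, LinearMap.inl_apply, LinearMap.inr_apply, smul_eq_mul, h4]
      at h1 h2
    rw [h1, h2]
  obtain ⟨ρ, hρ, hρm, hρi⟩ := exists_pos_weight h.aesm_right
  -- Chosen so that `re (eᵢ p) = cᵢ re p + dᵢ re (p * (-j))`, which is half the contribution of `p =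
  -- ∫ bᵢ v` to the functional.
  let e : Fin N → QC := fun i => c i • 1 - d i • unitJ
  have hQi : Integrable (fun x => (ρ x : ℂ) • ∑ i, e i * b i x) μ := by
    refine (integrable_finsetSum Finset.univ fun i _ => integrable_const_mul (hρi i) (e i)).congr
      (Eventually.of_forall fun x => ?_)
    simp only [Finset.smul_sum, mul_smul_comm]
  have hset : ∀ E : Set Λ, MeasurableSet E →
      ∫ x in E, (ρ x : ℂ) • ∑ i, e i * b i x ∂μ = 0 := by
    intro E hE
    refine eq_zero_of_re_mul_eq_zero fun q => ?_
    have hvm : AEStronglyMeasurable (E.indicator fun x => (ρ x : ℂ) • q) μ :=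
      ((Complex.continuous_ofReal.comp_aestronglyMeasurable hρm).smul_const q).indicator hE
    have hbv : ∀ i, (fun y => b i y * (E.indicator (fun x => (ρ x : ℂ) • q) y)) =
        E.indicator fun y => ((ρ y : ℂ) • b i y) * q := by
      intro i
      funext y
      by_cases hy : y ∈ E
      · simp only [Set.indicator_of_mem hy, mul_smul_comm, smul_mul_assoc]
      · simp only [Set.indicator_of_notMem hy, mul_zero]
    have hae : ∀ i, (fun y => b i y * (E.indicator (fun x => (ρ x : ℂ) • q) y)) =ᵐ[μ]
        fun y => b i y * (AEEqFun.mk _ hvm : Λ →ₘ[μ] QC) y := by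
      intro i
      filter_upwards [AEEqFun.coeFn_mk _ hvm] with y hy
      rw [hy]
    have hint : ∀ i, Integrable (fun y => ((ρ y : ℂ) • b i y) * q) μ := fun i =>
      integrable_mul_const (hρi i) q
    have hv : AEEqFun.mk _ hvm ∈ kernelDomain μ K := by
      rw [h.mem_kernelDomain_iff ha]
      intro i
      refine Integrable.congr ?_ (hae i)
      rw [hbv i]
      exact (hint i).indicator hE
    have hI : ∀ i, ∫ y, b i y * (AEEqFun.mk _ hvm : Λ →ₘ[μ] QC) y ∂μ =
        (∫ y in E, (ρ y : ℂ) • b i y ∂μ) * q := by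
      intro i
      rw [← integral_congr_ae (hae i), hbv i, integral_indicator hE,
        integral_mul_const' (hρi i).integrableOn]
    have h0 := LinearMap.mem_ker.1 (hφ (LinearMap.mem_range_self (analysis h ha) ⟨_, hv⟩))
    rw [hφv] at h0
    simp only [analysis_fst, analysis_snd, hI] at h0
    have hsum : ∫ x in E, (ρ x : ℂ) • ∑ i, e i * b i x ∂μ =
        ∑ i, e i * ∫ x in E, (ρ x : ℂ) • b i x ∂μ := by
      simp only [Finset.smul_sum, ← mul_smul_comm]
      rw [integral_finsetSum _ fun i _ => integrable_const_mul (hρi i).integrableOn (e i)]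
      exact Finset.sum_congr rfl fun i _ => integral_const_mul' (hρi i).integrableOn _
    rw [hsum, Finset.sum_mul, re_sum]
    refine mul_left_cancel₀ (two_ne_zero (α := ℂ)) ?_
    rw [mul_zero, Finset.mul_sum]
    refine Eq.trans (Finset.sum_congr rfl fun i _ => ?_) h0
    rw [mul_assoc, re_mul_comm]
    generalize (∫ x in E, (ρ x : ℂ) • b i x ∂μ) * q = p
    simp [e]
    ring
  have hQ0 := hQi.ae_eq_zero_of_forall_setIntegral_eq_zero fun E hE _ => hset E hE
  have hQ : ∀ᵐ x ∂μ, ∑ i, e i * b i x = 0 := by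
    filter_upwards [hQ0] with x hx
    have hx' : (ρ x : ℂ) • ∑ i, e i * b i x = 0 := hx
    exact (smul_eq_zero.1 hx').resolve_left (by exact_mod_cast (hρ x).ne')
  have hc0 : c = 0 := by
    refine hb c ?_
    filter_upwards [hQ] with x hx
    have h2 := congrArg (fun q => proj * q) hx
    simp only [Finset.mul_sum, mul_zero] at h2
    rw [← h2]
    refine Finset.sum_congr rfl fun i _ => ?_
    conv_rhs => rw [← h.proj_mul_right i x]
    have : proj * e i * proj = c i • proj := by
      rw [mul_sub, sub_mul, mul_smul_comm, mul_smul_comm, mul_one, smul_mul_assoc, smul_mul_assoc,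
        proj_mul_unitJ_mul_proj, proj_mul_proj, smul_zero, sub_zero]
    rw [← mul_assoc, ← mul_assoc, this, smul_mul_assoc, h.proj_mul_right]
  have hd0 : d = 0 := by
    refine hb d ?_
    filter_upwards [hQ] with x hx
    have h2 := congrArg (fun q => proj * unitJ * q) hx
    simp only [Finset.mul_sum, mul_zero] at h2
    rw [← h2]
    refine Finset.sum_congr rfl fun i _ => ?_
    conv_rhs => rw [← h.proj_mul_right i x]
    have : proj * unitJ * e i * proj = d i • proj := by
      rw [mul_sub, sub_mul, mul_smul_comm, mul_smul_comm, mul_one, smul_mul_assoc, smul_mul_assoc,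
        proj_mul_unitJ_mul_proj, mul_assoc proj, unitJ_mul_unitJ, smul_zero, zero_sub, mul_neg,
        mul_one, neg_mul, proj_mul_proj, smul_neg, neg_neg]
    rw [← mul_assoc, ← mul_assoc, this, smul_mul_assoc, h.proj_mul_right]
  refine LinearMap.ext fun v => ?_
  rw [hφv, LinearMap.zero_apply]
  exact Finset.sum_eq_zero fun i _ => by rw [hc0, hd0]; simp

/-- The integral operator with a self-dual finite-rank kernel: its rank and its eigenvalues. -/
theorem exists_integralOperator [SigmaFinite μ] (hself : ∀ x y, K y x = star (K x y))
    (hK : IsFiniteRankKernel μ K) :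
    ∃ T : Module.End ℂ (kernelDomain μ K), IsIntegralOperator μ K T ∧
      ∃ (r : ℕ) (lam : Fin r → ℂ), HasQuaternionRank T r ∧ IsEigenvalueList T lam ∧
        ∃ (N : ℕ) (a b : Fin N → Λ → QC), IsFactorization μ K a b ∧
          ∀ l, (gram μ a b ^ l).trace = 2 * ∑ k, lam k ^ l := by
  obtain ⟨N, a, b, h, ha, hb⟩ := exists_isFactorization_aeIndep hself hK
  obtain ⟨γ, ω, hγ, hω, hdet, hG⟩ := h.exists_gram_eq_mul hself ha hb
  obtain ⟨r, hr, lam, hmult, htr⟩ := exists_half_spectrum γ ω hγ hω hdet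
  have hrange : LinearMap.range (synthesis h ha ∘ₗ analysis h ha) =
      LinearMap.range (synthesis h ha) :=
    LinearMap.range_comp_of_range_eq_top _
      (LinearMap.range_eq_top.2 (analysis_surjective h ha hb))
  refine ⟨synthesis h ha ∘ₗ analysis h ha, isIntegralOperator_synthesis_comp_analysis h ha,
    r, lam, ⟨?_, ?_⟩, fun c hc => ?_, N, a, b, h, hG ▸ htr⟩
  · rw [hrange]
    infer_instance
  · rw [hrange, LinearMap.finrank_range_of_inj (synthesis_injective h ha), Module.finrank_prod,
      Module.finrank_pi, Fintype.card_fin, hr]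
    ring
  · rw [finrank_maxGenEigenspace_comp _ _ (synthesis_injective h ha) hc, analysis_comp_synthesis,
      finrank_maxGenEigenspace_prodMap, hG, hmult]
    ring

end Operator

/-! ### The number of points of a Pfaffian field with a finite-rank kernel -/

section NumberOfPoints

variable {Λ : Type*}

lemma fallingFactorial_natCast (n k : ℕ) :
    fallingFactorial (n : ℕ∞) k = (n.descFactorial k : ℝ≥0∞) := by
  rw [fallingFactorial, Nat.descFactorial_eq_prod_range, Nat.cast_prod]
  refine Finset.prod_congr rfl fun j _ => ?_
  rw [ENat.toENNReal_coe, ENNReal.natCast_sub]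

lemma lt_of_fallingFactorial_eq_zero {n : ℕ∞} {k : ℕ} (h : fallingFactorial n k = 0) :
    n < k := by
  induction n using ENat.recTopCoe with
  | top =>
    obtain ⟨j, _, hj⟩ := Finset.prod_eq_zero_iff.1 h
    simp at hj
  | coe n =>
    rw [fallingFactorial_natCast, Nat.cast_eq_zero, Nat.descFactorial_eq_zero_iff_lt] at h
    exact_mod_cast h

/-- The binomial theorem, padded with vanishing terms so that the range of summation does not depend
on `n`. -/
lemma one_add_pow_eq_sum_descFactorial (z : ℂ) {n r : ℕ} (h : n ≤ r) :
    (1 + z) ^ n =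
      ∑ k ∈ Finset.range (r + 1), ((k.factorial : ℂ)⁻¹ * z ^ k) * (n.descFactorial k : ℂ) := by
  rw [add_comm, add_pow]
  refine (Finset.sum_subset (Finset.range_subset_range.2 (Nat.succ_le_succ h)) ?_).trans
    (Finset.sum_congr rfl fun k _ => ?_)
  · intro k _ hk
    rw [Nat.choose_eq_zero_of_lt (by simpa using hk), Nat.cast_zero, mul_zero]
  · have hk : (k.factorial : ℂ) ≠ 0 := by exact_mod_cast k.factorial_ne_zero
    rw [Nat.descFactorial_eq_factorial_mul_choose, one_pow, Nat.cast_mul]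
    field_simp

variable [MeasurableSpace Λ]

lemma measurable_count_univ : Measurable fun c : Configuration Λ => c.count Set.univ :=
  measurable_iff_comap_le.2 (le_iSup₂_of_le Set.univ MeasurableSet.univ le_rfl)

variable {μ : Measure Λ} {P : Measure (Configuration Λ)} {K : Λ → Λ → QC}

lemma IsCorrelationFunction.lintegral_fallingFactorial {k : ℕ} {R : (Fin k → Λ) → ℝ}
    (hR : IsCorrelationFunction P μ k R) :
    ∫⁻ c, fallingFactorial (c.count Set.univ) k ∂P =
      ∫⁻ x, ENNReal.ofReal (R x) ∂(Measure.pi fun _ => μ) := by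
  have h := hR.lintegral_eq 1 (fun _ => Set.univ) (fun _ => k) (by simp)
    (fun _ => MeasurableSet.univ) (fun i j hij => absurd (Subsingleton.elim i j) hij)
  simpa using h

lemma IsPfaffianField.lintegral_fallingFactorial [SigmaFinite μ] [IsProbabilityMeasure P]
    (hP : IsPfaffianField P μ K) {N : ℕ} {a b : Fin N → Λ → QC} (h : IsFactorization μ K a b)
    {r : ℕ} (lam : Fin r → ℂ) (hG : ∀ l, (gram μ a b ^ l).trace = 2 * ∑ k, lam k ^ l) (k : ℕ) :
    ∫⁻ c, fallingFactorial (c.count Set.univ) k ∂P ≠ ⊤ ∧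
      ((∫⁻ c, fallingFactorial (c.count Set.univ) k ∂P).toReal : ℂ) = injSum lam k := by
  -- Correlation functions are given only from order 1; both sides are 1 for `k = 0`.
  rcases Nat.eq_zero_or_pos k with rfl | hk
  · simp [fallingFactorial, injSum_zero]
  obtain ⟨R, hR, hRK⟩ := hP.correlation k hk
  obtain ⟨hint, hval⟩ := integral_mooreDet_kernel hP.selfDual h lam hG k
  have hae : (fun x : Fin k → Λ =>
      (mooreDet (Matrix.of fun i j => K (x i) (x j))).re) =ᵐ[Measure.pi fun _ => μ]
        fun x => (R x : ℂ) := by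
    filter_upwards [hRK] with x hx
    rw [← hx]
    rfl
  have hRC : Integrable (fun x => (R x : ℂ)) (Measure.pi fun _ => μ) :=
    (integrable_re hint).congr hae
  have hRi : Integrable R (Measure.pi fun _ => μ) := hRC.re
  have hRval : ((∫ x, R x ∂(Measure.pi fun _ => μ) : ℝ) : ℂ) = injSum lam k := by
    rw [← integral_complex_ofReal, ← integral_congr_ae hae, integral_re hint, hval]
    rfl
  rw [hR.lintegral_fallingFactorial,
    ← ofReal_integral_eq_lintegral_ofReal hRi (Eventually.of_forall hR.nonneg)]
  refine ⟨ENNReal.ofReal_ne_top, ?_⟩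
  rw [ENNReal.toReal_ofReal (integral_nonneg hR.nonneg), hRval]

/-- The factorial moment of order `r + 1` is a multiple of an elementary symmetric function of `r`
numbers of that order, hence zero. A nonnegative variable with zero mean vanishes almost surely. -/
lemma IsPfaffianField.ae_count_le [SigmaFinite μ] [IsProbabilityMeasure P]
    (hP : IsPfaffianField P μ K) {N : ℕ} {a b : Fin N → Λ → QC} (h : IsFactorization μ K a b)
    {r : ℕ} (lam : Fin r → ℂ) (hG : ∀ l, (gram μ a b ^ l).trace = 2 * ∑ k, lam k ^ l) :
    ∀ᵐ c ∂P, ∃ n : ℕ, n ≤ r ∧ c.count Set.univ = (n : ℕ∞) := by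
  obtain ⟨hfin, hval⟩ := hP.lintegral_fallingFactorial h lam hG (r + 1)
  rw [injSum_eq_zero lam (Nat.lt_succ_self r), Complex.ofReal_eq_zero,
    ENNReal.toReal_eq_zero_iff, or_iff_left hfin, lintegral_eq_zero_iff] at hval
  · filter_upwards [hval] with c hc
    have hlt := lt_of_fallingFactorial_eq_zero hc
    obtain ⟨n, hn⟩ := ENat.ne_top_iff_exists.1 hlt.ne_top
    rw [← hn] at hlt ⊢
    exact ⟨n, Nat.lt_succ_iff.1 (by exact_mod_cast hlt), rfl⟩
  · exact (measurable_from_top (f := fun n : ℕ∞ => fallingFactorial n (r + 1))).comp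
      measurable_count_univ

/-- Since the count is at most `r`, `e^{it𝒩} = (1 + z)^𝒩` is a fixed finite combination of falling
factorials, and the expectation is taken term by term. -/
lemma IsPfaffianField.integral_exp [SigmaFinite μ] [IsProbabilityMeasure P]
    (hP : IsPfaffianField P μ K) {N : ℕ} {a b : Fin N → Λ → QC} (h : IsFactorization μ K a b)
    {r : ℕ} (lam : Fin r → ℂ) (hG : ∀ l, (gram μ a b ^ l).trace = 2 * ∑ k, lam k ^ l) (t : ℝ) :
    ∫ c, Complex.exp (Complex.I * ((c.count Set.univ).toNat : ℂ) * (t : ℂ)) ∂P =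
      ∏ k, (1 + (Complex.exp (Complex.I * (t : ℂ)) - 1) * lam k) := by
  set z := Complex.exp (Complex.I * (t : ℂ)) - 1 with hz
  have hae : ∀ᵐ c ∂P, Complex.exp (Complex.I * ((c.count Set.univ).toNat : ℂ) * (t : ℂ)) =
      ∑ k ∈ Finset.range (r + 1), ((k.factorial : ℂ)⁻¹ * z ^ k) *
        ((fallingFactorial (c.count Set.univ) k).toReal : ℂ) := by
    filter_upwards [hP.ae_count_le h lam hG] with c hc
    obtain ⟨n, hn, hcn⟩ := hc
    have hexp : Complex.exp (Complex.I * (n : ℂ) * (t : ℂ)) = (1 + z) ^ n := by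
      rw [hz, add_sub_cancel, ← Complex.exp_nat_mul]
      congr 1
      ring
    rw [hcn, ENat.toNat_natCast, hexp, one_add_pow_eq_sum_descFactorial z hn]
    refine Finset.sum_congr rfl fun k _ => ?_
    rw [fallingFactorial_natCast, ENNReal.toReal_natCast, Complex.ofReal_natCast]
  have hmeas : ∀ k, AEMeasurable (fun c : Configuration Λ =>
      fallingFactorial (c.count Set.univ) k) P := fun k =>
    ((measurable_from_top (f := fun n : ℕ∞ => fallingFactorial n k)).comp
      measurable_count_univ).aemeasurable
  have hint : ∀ k, Integrable (fun c : Configuration Λ =>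
      ((fallingFactorial (c.count Set.univ) k).toReal : ℂ)) P := fun k =>
    (integrable_toReal_of_lintegral_ne_top (hmeas k)
      (hP.lintegral_fallingFactorial h lam hG k).1).ofReal
  rw [integral_congr_ae hae, integral_finsetSum _ fun k _ => (hint k).const_mul _,
    ← sum_injSum_div_factorial]
  refine Finset.sum_congr rfl fun k _ => ?_
  obtain ⟨hfin, hval⟩ := hP.lintegral_fallingFactorial h lam hG k
  rw [integral_const_mul, integral_complex_ofReal,
    integral_toReal (hmeas k) (ae_lt_top' (hmeas k) hfin), hval, injSum_mul_left]
  ring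

lemma IsFactorization.const_smul {N : ℕ} {a b : Fin N → Λ → QC} (h : IsFactorization μ K a b)
    (z : ℂ) : IsFactorization μ (fun x y => z • K x y) (fun i x => z • a i x) b := by
  obtain ⟨S, hS, hK⟩ := h.exists_eq
  refine ⟨fun i => (h.aesm_left i).const_smul z, h.aesm_right, fun i x => ?_, h.proj_mul_right,
    fun i j => ?_, S, hS, fun x hx y hy => ?_⟩
  · rw [smul_mul_assoc, h.left_mul_proj]
  · refine ((h.integrable_mul i j).smul z).congr (Eventually.of_forall fun x => ?_)
    simp only [Pi.smul_apply, mul_smul_comm]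
  · rw [hK x hx y hy, Finset.smul_sum]
    exact Finset.sum_congr rfl fun i _ => (smul_mul_assoc _ _ _).symm

lemma gram_const_smul {N : ℕ} (a b : Fin N → Λ → QC) (z : ℂ) :
    gram μ (fun i x => z • a i x) b = z • gram μ a b := by
  ext i j
  simp only [gram, Matrix.smul_apply, Matrix.of_apply, smul_eq_mul]
  rw [← integral_const_mul]
  congr 1
  funext x
  simp only [pairing, Matrix.of_apply, mul_smul_comm, re_smul]
  ring

/-- Scaling the kernel scales the Gram matrix and `lam`. The terms of order above `r` vanish, so the
series is the finite expansion of the product. -/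
lemma isFredholmDet_const_smul [SigmaFinite μ] (hself : ∀ x y, K y x = star (K x y)) {N : ℕ}
    {a b : Fin N → Λ → QC} (h : IsFactorization μ K a b) {r : ℕ} (lam : Fin r → ℂ)
    (hG : ∀ l, (gram μ a b ^ l).trace = 2 * ∑ k, lam k ^ l) (z : ℂ) :
    IsFredholmDet μ (fun x y => z • K x y) ((∏ k, (1 + z * lam k) : ℂ) : QC) := by
  have hmain := fun n => integral_mooreDet_kernel (K := fun x y => z • K x y)
    (fun x y => by rw [hself x y, star_smul_eq]) (h.const_smul z) (fun k => z * lam k)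
    (fun l => by
      rw [gram_const_smul, smul_pow, Matrix.trace_smul, hG, smul_eq_mul, Finset.mul_sum,
        Finset.mul_sum, Finset.mul_sum]
      exact Finset.sum_congr rfl fun k _ => by ring) n
  refine ⟨fun n _ => (hmain n).1, ((∑ n ∈ Finset.range r, (((n + 1).factorial : ℂ)⁻¹) *
    injSum (fun k => z * lam k) (n + 1) : ℂ) : QC), ?_, ?_⟩
  · rw [← sum_injSum_div_factorial, Finset.sum_range_succ', injSum_zero, Nat.factorial_zero,
      Nat.cast_one, inv_one, one_mul, add_comm]
    exact QuaternionAlgebra.coe_add _ _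
  · rw [coe_sum]
    have hterm : ∀ n : ℕ, (((n + 1).factorial : ℂ)⁻¹) • ∫ x : Fin (n + 1) → Λ,
        mooreDet (Matrix.of fun i j => z • K (x i) (x j)) ∂(Measure.pi fun _ => μ) =
        (((((n + 1).factorial : ℂ)⁻¹) * injSum (fun k => z * lam k) (n + 1) : ℂ) : QC) := by
      intro n
      rw [(hmain (n + 1)).2, smul_eq_coe_mul]
      exact (QuaternionAlgebra.coe_mul _ _).symm
    simp only [hterm]
    refine hasSum_sum_of_ne_finset_zero fun n hn => ?_
    rw [injSum_eq_zero _ (by simp at hn; omega), mul_zero]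
    rfl

end NumberOfPoints

end PfaffianField

end

theorem theorem5 {Λ : Type*} [MeasurableSpace Λ] (μ : MeasureTheory.Measure Λ)
    [MeasureTheory.SigmaFinite μ]
    (P : MeasureTheory.Measure (PfaffianField.Configuration Λ))
    [MeasureTheory.IsProbabilityMeasure P]
    (K : Λ → Λ → PfaffianField.QC)
    (hP : PfaffianField.IsPfaffianField P μ K)
    (hK : PfaffianField.IsFiniteRankKernel μ K) :
    -- the total number of points is almost surely finite
    (∀ᵐ c ∂P, c.count Set.univ ≠ ⊤) ∧
    -- the integral operator with kernel `K`, its rank and its eigenvalues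
    ∃ T : Module.End ℂ (PfaffianField.kernelDomain μ K),
      PfaffianField.IsIntegralOperator μ K T ∧
      ∃ (r : ℕ) (lam : Fin r → ℂ),
        PfaffianField.HasQuaternionRank T r ∧
        PfaffianField.IsEigenvalueList T lam ∧
        ∀ t : ℝ,
          ∫ c, Complex.exp (Complex.I * ((c.count Set.univ).toNat : ℂ) * (t : ℂ)) ∂P =
            ∏ k, (1 + (Complex.exp (Complex.I * (t : ℂ)) - 1) * lam k) ∧
          PfaffianField.IsFredholmDet μ
            (fun x y => (Complex.exp (Complex.I * (t : ℂ)) - 1) • K x y)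
            ((∏ k, (1 + (Complex.exp (Complex.I * (t : ℂ)) - 1) * lam k) : ℂ) : PfaffianField.QC) := by
  obtain ⟨T, hT, r, lam, hr, hlam, N, a, b, hab, hG⟩ :=
    PfaffianField.exists_integralOperator hP.selfDual hK
  refine ⟨?_, T, hT, r, lam, hr, hlam, fun t => ⟨hP.integral_exp hab lam hG t, ?_⟩⟩
  · filter_upwards [hP.ae_count_le hab lam hG] with c hc
    obtain ⟨n, _, hn⟩ := hc
    rw [hn]
    exact ENat.natCast_ne_top n
  · exact PfaffianField.isFredholmDet_const_smul hP.selfDual hab lam hG _
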